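/- Let $D_\infty=\{(x,y): 0<y\le x\}$, let $\overline e_0>0$, $\overline v>0$ and $\overline e(t)=\overline e_0+t\overline v$ for $t\ge 0$. For $a,b\in\mathbb R$ consider on $D_\infty$ the problem $$\partial_{xx}k-\partial_{yy}k=a\,k\ \text{ in } D_\infty,\qquad \partial_y k(x,0)=0,\qquad k(x,x)=-\tfrac b2\,x\qquad(x>0).\tag{$P_{a,b}$}$$ A function $k:D_\infty\to\mathbb R$ is a weak solution of $(P_{a,b})$ if (i) the extension $\overline k$ of $k$ to $[0,\infty)^2$ by $\overline k(x,y)=-\frac b2x$ outside $D_\infty$ satisfies, for every $L>0$, $\overline k\in C^0([0,L],H^1(0,L))$, $\partial_x\overline k\in C^0([0,L],L^2(0,L))$ and $\partial_{xx}\overline k\in C^0([0,L],H^1(0,L)')$, where $\overline k$ is regarded as the map $x\mapsto\overline k(x,\cdot)$; and (ii) for all $L>0$ and all $v,w\in H^1(0,L)$, $$-\int_0^L\Big(\int_0^x\partial_xk(x,y)v(y)\,dy\Big)w'(x)\,dx+w(L)\int_0^L\partial_xk(L,y)v(y)\,dy+\int_0^L\Big(\int_0^x\partial_yk(x,y)v'(y)\,dy\Big)w(x)\,dx$$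 $$=a\int_0^L\Big(\int_0^xk(x,y)v(y)\,dy\Big)w(x)\,dx-\frac b2\int_0^Lv(x)w(x)\,dx.$$ For every $\sigma>0$ and $\lambda\ge0$, the problem $(P_{a,b})$ with $a=b=\lambda/\sigma$ has a unique weak solution $k_\lambda^\sigma$, and the problem with $a=-\lambda/\sigma$, $b=\lambda/\sigma$ has a unique weak solution $l_\lambda^\sigma$ (unique in the sense that for every $x>0$ the values at $(x,y)$ are determined for almost every $y\in(0,x)$). Moreover, there exist constants $C,c>0$, depending only on $\overline e_0$ and $\overline v$ (in particular not on $\sigma$, $\lambda$, $t$, $x$), and for every $\sigma>0$ there exists $\lambda_\sigma>0$, such that for all $\lambda\ge\lambda_\sigma$, all $t\ge0$ and all $x\in(0,\overline e(t))$, $$\int_0^x\big(|k_\lambda^\sigma(x,y)|^2+|\nabla k_\lambda^\sigma(x,y)|^2\big)\,dy\le C\,e^{c\,\overline e(t)\sqrt{\lambda/\sigma}},$$ $$\int_0^x\big(|l_\lambda^\sigma(x,y)|^2+|\nabla l_\lambda^\sigma(x,y)|^2\big)\,dy\le C\Big(\frac\lambda\sigma\Big)^4e^{c\,\overline e(t)}.$$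 -/

import Mathlib

open MeasureTheory Set
open scoped ContDiff

noncomputable section

namespace KernelProblem

/-- The space `L²(0, L)`. -/
abbrev L2 (L : ℝ) : Type := Lp ℝ 2 (volume.restrict (Ioo 0 L))

/-- Test functions on `(0, L)`: smooth with compact support in `(0, L)`. -/
structure IsTestFunction (L : ℝ) (φ : ℝ → ℝ) : Prop where
  smooth : ContDiff ℝ ∞ φ
  compact : HasCompactSupport φ
  support : tsupport φ ⊆ Ioo 0 L

/-- `g ∈ L²(0, L)` is the weak derivative of `f ∈ L²(0, L)`. -/
def HasWeakDeriv (L : ℝ) (f g : L2 L) : Prop :=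
  ∀ φ : ℝ → ℝ, IsTestFunction L φ →
    ∫ y in Ioo 0 L, f y * deriv φ y = - ∫ y in Ioo 0 L, g y * φ y

theorem IsTestFunction.memLp {L : ℝ} {φ : ℝ → ℝ} (h : IsTestFunction L φ) :
    MemLp φ 2 (volume.restrict (Ioo 0 L)) :=
  (h.smooth.continuous.memLp_of_hasCompactSupport h.compact).restrict _

theorem IsTestFunction.deriv_memLp {L : ℝ} {φ : ℝ → ℝ} (h : IsTestFunction L φ) :
    MemLp (deriv φ) 2 (volume.restrict (Ioo 0 L)) :=
  ((h.smooth.continuous_deriv (by simp)).memLp_of_hasCompactSupport h.compact.deriv).restrict _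

theorem integral_add_mul {L : ℝ} (f g : L2 L) {ψ : ℝ → ℝ}
    (hψ : MemLp ψ 2 (volume.restrict (Ioo 0 L))) :
    ∫ y in Ioo 0 L, (f + g : L2 L) y * ψ y
      = (∫ y in Ioo 0 L, f y * ψ y) + ∫ y in Ioo 0 L, g y * ψ y := by
  have hf : Integrable (fun y => f y * ψ y) (volume.restrict (Ioo 0 L)) :=
    (Lp.memLp f).integrable_mul hψ
  have hg : Integrable (fun y => g y * ψ y) (volume.restrict (Ioo 0 L)) :=
    (Lp.memLp g).integrable_mul hψ
  rw [← integral_add hf hg]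
  refine integral_congr_ae ?_
  filter_upwards [Lp.coeFn_add f g] with y hy
  rw [hy, Pi.add_apply, add_mul]

theorem integral_smul_mul {L : ℝ} (c : ℝ) (f : L2 L) (ψ : ℝ → ℝ) :
    ∫ y in Ioo 0 L, (c • f : L2 L) y * ψ y = c * ∫ y in Ioo 0 L, f y * ψ y := by
  rw [← integral_const_mul]
  refine integral_congr_ae ?_
  filter_upwards [Lp.coeFn_smul c f] with y hy
  rw [hy, Pi.smul_apply, smul_eq_mul, mul_assoc]

theorem integral_zero_mul {L : ℝ} (ψ : ℝ → ℝ) :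
    ∫ y in Ioo 0 L, (0 : L2 L) y * ψ y = 0 := by
  simpa using integral_smul_mul (L := L) 0 0 ψ

/-- The Sobolev space `H¹(0, L)`, as the space of pairs `(u, u')` in `L² × L²` in which `u'` is the
weak derivative of `u`; its norm is `(‖u‖² + ‖u'‖²)^(1/2)`. -/
def H1 (L : ℝ) : Submodule ℝ (WithLp 2 (L2 L × L2 L)) where
  carrier := {p | HasWeakDeriv L p.fst p.snd}
  add_mem' := by
    intro p q hp hq φ hφ
    have h1 := hp φ hφ
    have h2 := hq φ hφ
    simp only [WithLp.add_fst, WithLp.add_snd]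
    rw [integral_add_mul _ _ hφ.memLp, integral_add_mul _ _ hφ.deriv_memLp, h1, h2]
    ring
  zero_mem' := by
    intro φ hφ
    simp only [WithLp.zero_fst, WithLp.zero_snd, integral_zero_mul, neg_zero]
  smul_mem' := by
    intro c p hp φ hφ
    have h1 := hp φ hφ
    simp only [WithLp.smul_fst, WithLp.smul_snd, integral_smul_mul, h1]
    ring

/-- The underlying function of an element of `H¹(0, L)`. -/
def H1.toL2 (L : ℝ) : H1 L →L[ℝ] L2 L := (WithLp.fstL 2 ℝ (L2 L) (L2 L)).comp (H1 L).subtypeL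

/-- The weak derivative of an element of `H¹(0, L)`. -/
def H1.weakDeriv (L : ℝ) : H1 L →L[ℝ] L2 L :=
  (WithLp.sndL 2 ℝ (L2 L) (L2 L)).comp (H1 L).subtypeL

/-- `c` is the boundary value at `y = L` of `w ∈ H¹(0, L)`: the value at `L` of a representative
of `w` that is continuous on `[0, L]`. -/
def H1.HasValueAtEnd (L : ℝ) (w : H1 L) (c : ℝ) : Prop :=
  ∃ r : ℝ → ℝ, ContinuousOn r (Icc 0 L) ∧
    (H1.toL2 L w : ℝ → ℝ) =ᵐ[volume.restrict (Ioo 0 L)] r ∧ r L = c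

/-- The embedding of `L²(0, L)` in the dual of `H¹(0, L)`: `u ↦ (v ↦ ∫ u v)`. -/
def toDual (L : ℝ) (u : L2 L) : StrongDual ℝ (H1 L) := (innerSL ℝ u).comp (H1.toL2 L)

/-- The extension of a kernel `k` on the triangle `{0 < y ≤ x}` by `-(b/2) x`. -/
def extendKernel (b : ℝ) (k : ℝ → ℝ → ℝ) (x y : ℝ) : ℝ :=
  open Classical in if 0 < y ∧ y ≤ x then k x y else -(b / 2) * x

/-- `x ↦ f(x, ·)` belongs to `C⁰([0, L], H¹(0, L))`, with partial derivatives
`∂ₓf = fx ∈ C⁰([0, L], L²(0, L))`, `∂_y f = fy`, and `∂ₓₓf ∈ C⁰([0, L], H¹(0, L)')`. -/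
def IsRegularOn (L : ℝ) (f fx fy : ℝ → ℝ → ℝ) : Prop :=
  ∃ (U : ℝ → H1 L) (P : ℝ → L2 L) (R : ℝ → StrongDual ℝ (H1 L)),
    ContinuousOn U (Icc 0 L) ∧ ContinuousOn P (Icc 0 L) ∧ ContinuousOn R (Icc 0 L) ∧
    (∀ x ∈ Icc 0 L,
      (H1.toL2 L (U x) : ℝ → ℝ) =ᵐ[volume.restrict (Ioo 0 L)] f x ∧
      (H1.weakDeriv L (U x) : ℝ → ℝ) =ᵐ[volume.restrict (Ioo 0 L)] fy x ∧
      (P x : ℝ → ℝ) =ᵐ[volume.restrict (Ioo 0 L)] fx x) ∧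
    (∀ x ∈ Icc 0 L, HasDerivWithinAt (fun s => H1.toL2 L (U s)) (P x) (Icc 0 L) x) ∧
    (∀ x ∈ Icc 0 L, HasDerivWithinAt (fun s => toDual L (P s)) (R x) (Icc 0 L) x)

/-- The extension of `k` by `-(b/2) x` has, on every square `[0, L]²`, the regularity required of a
weak solution, and `kx`, `ky` are its partial derivatives. On the triangle they are the partial
derivatives of `k` itself. -/
def HasPartials (b : ℝ) (k kx ky : ℝ → ℝ → ℝ) : Prop :=
  ∀ L : ℝ, 0 < L → IsRegularOn L (extendKernel b k) kx ky

/-- The weak formulation, on the triangle `{0 < y ≤ x}`, of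
`∂ₓₓk - ∂_yy k = a k`, `∂_y k(x, 0) = 0`, `k(x, x) = -(b/2) x`. -/
def WeakIdentity (a b : ℝ) (k kx ky : ℝ → ℝ → ℝ) : Prop :=
  ∀ L : ℝ, 0 < L → ∀ (v w : H1 L) (wL : ℝ), H1.HasValueAtEnd L w wL →
    - (∫ x in 0..L, (∫ y in 0..x, kx x y * H1.toL2 L v y) * H1.weakDeriv L w x)
      + wL * (∫ y in 0..L, kx L y * H1.toL2 L v y)
      + (∫ x in 0..L, (∫ y in 0..x, ky x y * H1.weakDeriv L v y) * H1.toL2 L w x)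
    = a * (∫ x in 0..L, (∫ y in 0..x, k x y * H1.toL2 L v y) * H1.toL2 L w x)
      - b / 2 * ∫ x in 0..L, H1.toL2 L v x * H1.toL2 L w x

/-- `k` is a weak solution of `∂ₓₓk - ∂_yy k = a k` on the triangle `{0 < y ≤ x}` with
`∂_y k(x, 0) = 0` and `k(x, x) = -(b/2) x`. Only the values of `k` on the triangle matter. -/
def IsWeakSolution (a b : ℝ) (k : ℝ → ℝ → ℝ) : Prop :=
  ∃ kx ky : ℝ → ℝ → ℝ, HasPartials b k kx ky ∧ WeakIdentity a b k kx ky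

/-- Weak solutions of the direct kernel problem. -/
def IsDirectKernel (σ lam : ℝ) (k : ℝ → ℝ → ℝ) : Prop :=
  IsWeakSolution (lam / σ) (lam / σ) k

/-- Weak solutions of the inverse kernel problem: the sign of the zeroth order term changes,
the value on the diagonal does not. -/
def IsInverseKernel (σ lam : ℝ) (l : ℝ → ℝ → ℝ) : Prop :=
  IsWeakSolution (-(lam / σ)) (lam / σ) l

/-- There is exactly one kernel on the triangle with the property `S`; two kernels are identified
if, for every `x > 0`, they agree at almost every `y ∈ (0, x)`. -/
def ExistsUniqueKernel (S : (ℝ → ℝ → ℝ) → Prop) : Prop :=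
  ∃ k : ℝ → ℝ → ℝ, S k ∧
    ∀ k' : ℝ → ℝ → ℝ, S k' → ∀ x : ℝ, 0 < x →
      ∀ᵐ y ∂(volume.restrict (Ioo 0 x)), k' x y = k x y

/-- `∫₀ˣ (|k|² + |∇k|²) dy`, where `∇k = (kx, ky)`. -/
def sliceEnergy (k kx ky : ℝ → ℝ → ℝ) (x : ℝ) : ℝ :=
  ∫ y in 0..x, (k x y ^ 2 + (kx x y ^ 2 + ky x y ^ 2))

/-- The thickness `ē(t) = ē₀ + t v̄`. -/
def thickness (e₀ vbar t : ℝ) : ℝ := e₀ + t * vbar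

end KernelProblem

end

/-! The problem is solved in closed form. Writing `bes m s = ∑ sⁿ / (n! (n+m)!)`, the kernel `-(b/2)
x bes 1 (a(x² - y²)/4)` is smooth on the whole plane. The argument vanishes on the diagonal and `bes
1 0 = 1`, which gives the diagonal value. Evenness in `y` gives the Neumann condition, and the
three-term recurrence of the Bessel functions gives the wave equation
(`isClassicalKernel_besselKernel`). Integration by parts shows that such a classical solution is a
weak one. Its extension is continuous across the diagonal but has a jump in `∂ₓ`, so `∂ₓₓ` contains
a point evaluation and lives only in the dual of `H¹` (`IsClassicalKernel.hasPartials`,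
`IsClassicalKernel.weakIdentity`).

Uniqueness comes from moments. Testing with `w = 1` and `v` such that `v'(0) = 0` gives a
second-order equation in `x` for `M_v(x) = ∫₀ˣ k(x,y) v(y) dy`, whose source contains `M_{v''}`. For
two solutions with the same `M_{v''}` the difference `D` of the moments satisfies `D' = a ∫ D` and
`D(0) = 0`, hence vanishes. The powers `v = y²ⁿ` are admissible and `v''` is a multiple of the
preceding one, so induction identifies all even moments (`even_moments_eq`). Polynomials in `y²` are
dense on `[0, x]`, so the slices agree almost everywhere (`weakSolution_unique`). The derivatives of
any weak solution are then those of the explicit kernel.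

The estimates are therefore estimates of `bes`: at `s ≥ 0` it is at most `exp (2√s)`, which produces
`exp (x √(λ/σ))` for the direct kernel; at negative arguments it oscillates and is at most `1` in
absolute value, so the inverse kernel grows only polynomially in `λ/σ`. -/

noncomputable section

namespace KernelProblem

open Filter Topology

/-! ### The Bessel series and its bounds -/

section

open Nat

/-- The entire function `∑ sⁿ / (n! (n + m)!)`, that is `s^(-m/2) I_m(2√s)`. -/
def bes (m : ℕ) (s : ℝ) : ℝ := ∑' n : ℕ, s ^ n / ((n ! : ℝ) * ((n + m)! : ℝ))

theorem factorial_mul_bound (n m : ℕ) : (n ! : ℝ) ≤ (n ! : ℝ) * ((n + m)! : ℝ) := by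
  have h1 : (1 : ℝ) ≤ ((n + m)! : ℝ) := by exact_mod_cast Nat.factorial_pos _
  have h2 : (0 : ℝ) ≤ (n ! : ℝ) := by positivity
  nlinarith

theorem bes_summable (m : ℕ) (s : ℝ) :
    Summable fun n : ℕ => s ^ n / ((n ! : ℝ) * ((n + m)! : ℝ)) := by
  refine Summable.of_norm_bounded (g := fun n => |s| ^ n / (n ! : ℝ))
    (Real.summable_pow_div_factorial |s|) fun n => ?_
  rw [Real.norm_eq_abs, abs_div, abs_pow, abs_of_pos (by positivity : (0:ℝ) < n ! * (n + m)!)]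
  gcongr
  exact factorial_mul_bound n m

/-- Termwise differentiation on a ball containing `s`: the factor `n` cancels against `n!`, and
shifting the index by one turns `(n+m)!` into `(n+(m+1))!`. -/
theorem bes_hasDerivAt (m : ℕ) (s : ℝ) : HasDerivAt (bes m) (bes (m + 1) s) s := by
  set R : ℝ := |s| + 1
  have key : ∀ (n : ℕ) (y : ℝ), ((n + 1 : ℕ) : ℝ) * y ^ n / (((n + 1)! : ℝ) * ((n + 1 + m)! : ℝ))
      = y ^ n / ((n ! : ℝ) * ((n + (m + 1))! : ℝ)) := by
    intro n y
    rw [Nat.factorial_succ n, show n + 1 + m = n + (m + 1) by ring]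
    push_cast
    have : (n ! : ℝ) ≠ 0 := by positivity
    have : (n : ℝ) + 1 ≠ 0 := by positivity
    field_simp
  have hsum : ∀ y : ℝ, Summable fun n : ℕ =>
      (n : ℝ) * y ^ (n - 1) / ((n ! : ℝ) * ((n + m)! : ℝ)) := by
    intro y
    rw [← summable_nat_add_iff 1]
    simpa only [Nat.add_sub_cancel, key] using bes_summable (m + 1) y
  have h := hasDerivAt_tsum_of_isPreconnected (𝕜 := ℝ) (F := ℝ) (t := Metric.ball 0 R)
    (g := fun (n : ℕ) y => y ^ n / ((n ! : ℝ) * ((n + m)! : ℝ)))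
    (g' := fun (n : ℕ) y => (n : ℝ) * y ^ (n - 1) / ((n ! : ℝ) * ((n + m)! : ℝ)))
    (u := fun (n : ℕ) => (n : ℝ) * R ^ (n - 1) / ((n ! : ℝ) * ((n + m)! : ℝ)))
    (y₀ := 0) (y := s) (hsum R) Metric.isOpen_ball (convex_ball _ _).isPreconnected
    (fun n y _ => (hasDerivAt_pow n y).div_const _) ?_
    (Metric.mem_ball_self (by positivity)) (bes_summable m 0) (by simp [R])
  · refine HasDerivAt.congr_deriv (f := bes m) h ?_
    rw [(hsum s).tsum_eq_zero_add]
    simp only [Nat.add_sub_cancel, key]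
    simp [bes]
  · intro n y hy
    have hy' : |y| ≤ R := by simpa using (mem_ball_zero_iff.mp hy).le
    rw [Real.norm_eq_abs, abs_div, abs_mul, abs_pow, Nat.abs_cast,
      abs_of_pos (by positivity : (0:ℝ) < n ! * (n + m)!)]
    gcongr

theorem bes_continuous (m : ℕ) : Continuous (bes m) :=
  continuous_iff_continuousAt.mpr fun s => (bes_hasDerivAt m s).continuousAt

theorem bes_zero (m : ℕ) : bes m 0 = 1 / (m ! : ℝ) := by
  rw [bes, tsum_eq_single 0]
  · simp
  · intro n hn
    simp [hn]

/-- Comparison of coefficients. The case `m = 1` is the wave equation for the explicit kernel; the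
general case makes the energy in `abs_bes_neg_le_one` decrease. -/
theorem bes_recurrence (m : ℕ) (s : ℝ) :
    s * bes (m + 2) s + (m + 1) * bes (m + 1) s = bes m s := by
  have e : ∀ n : ℕ, (m + 1 : ℝ) * (s ^ (n + 1) / (((n + 1)! : ℝ) * ((n + 1 + (m + 1))! : ℝ)))
      + s * (s ^ n / ((n ! : ℝ) * ((n + (m + 2))! : ℝ)))
      = s ^ (n + 1) / (((n + 1)! : ℝ) * ((n + 1 + m)! : ℝ)) := by
    intro n
    rw [show n + 1 + (m + 1) = n + (m + 1) + 1 by ring, show n + (m + 2) = n + (m + 1) + 1 by ring,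
      show n + 1 + m = n + (m + 1) by ring, Nat.factorial_succ n, Nat.factorial_succ (n + (m + 1))]
    push_cast
    have h1 : (n ! : ℝ) ≠ 0 := by positivity
    have h2 : (n : ℝ) + 1 ≠ 0 := by positivity
    have h3 : ((n + (m + 1))! : ℝ) ≠ 0 := by positivity
    have h4 : (n : ℝ) + (m + 1) + 1 ≠ 0 := by positivity
    field_simp
    ring
  have s0 := bes_summable m s
  have s1 := (bes_summable (m + 1) s).mul_left (m + 1 : ℝ)
  have s2 := (bes_summable (m + 2) s).mul_left s
  simp only [bes]
  rw [s0.tsum_eq_zero_add, ← tsum_mul_left, ← tsum_mul_left, s1.tsum_eq_zero_add, add_comm,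
    add_assoc, ← ((summable_nat_add_iff 1).mpr s1).tsum_add s2]
  simp only [e]
  congr 1
  rw [Nat.zero_add, Nat.zero_add, Nat.factorial_succ]
  push_cast
  have : (m ! : ℝ) ≠ 0 := by positivity
  have : (m : ℝ) + 1 ≠ 0 := by positivity
  field_simp

/-- Since `(n+m)! ≥ n!`, each term is at most the square of `√sⁿ / n!`. One factor is bounded by
`exp √s`, and the other sums to `exp √s`. -/
theorem abs_bes_le_exp (m : ℕ) {s : ℝ} (hs : 0 ≤ s) : |bes m s| ≤ Real.exp (2 * √s) := by
  have hr : 0 ≤ √s := Real.sqrt_nonneg s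
  have hnn : 0 ≤ bes m s := tsum_nonneg fun n => by positivity
  rw [abs_of_nonneg hnn]
  have h1 : HasSum (fun n : ℕ => √s ^ n / (n ! : ℝ)) (Real.exp (√s)) := by
    rw [Real.exp_eq_exp_ℝ]
    exact NormedSpace.expSeries_div_hasSum_exp (√s)
  have h2 : HasSum (fun n : ℕ => Real.exp (√s) * (√s ^ n / (n ! : ℝ)))
      (Real.exp (√s) * Real.exp (√s)) := h1.mul_left _
  rw [two_mul, Real.exp_add]
  refine hasSum_le (fun n => ?_) (bes_summable m s).hasSum h2
  calc s ^ n / ((n ! : ℝ) * ((n + m)! : ℝ)) ≤ s ^ n / ((n ! : ℝ) * (n ! : ℝ)) := by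
        gcongr
        exact Nat.le_add_right n m
    _ = (√s ^ n / (n ! : ℝ)) * (√s ^ n / (n ! : ℝ)) := by
        nth_rewrite 1 [← Real.mul_self_sqrt hs]
        rw [mul_pow]
        field_simp
    _ ≤ _ := by
        gcongr
        exact Real.pow_div_factorial_le_exp _ hr _

/-- The energy `r f'(r)² + f(r)²` of `f(r) = bes m (-r)` has derivative `-(2m+1) f'(r)²` by the
recurrence, so it never exceeds its initial value `1 / m!²`. -/
theorem abs_bes_neg_le_one (m : ℕ) {s : ℝ} (hs : 0 ≤ s) : |bes m (-s)| ≤ 1 := by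
  have hd : ∀ (j : ℕ) (r : ℝ), HasDerivAt (fun r => bes j (-r)) (-bes (j + 1) (-r)) r := by
    intro j r
    exact ((bes_hasDerivAt j (-r)).comp r (hasDerivAt_neg r)).congr_deriv (by ring)
  set E : ℝ → ℝ := fun r => r * bes (m + 1) (-r) ^ 2 + bes m (-r) ^ 2 with hE
  have hEd : ∀ r, HasDerivAt E (-(2 * m + 1) * bes (m + 1) (-r) ^ 2) r := by
    intro r
    have h := ((hasDerivAt_id r).mul ((hd (m + 1) r).pow 2)).add ((hd m r).pow 2)
    refine h.congr_deriv ?_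
    have hrec := bes_recurrence m (-r)
    simp only [id, Nat.cast_ofNat, Nat.add_one_sub_one, pow_one, Pi.pow_apply]
    rw [← hrec]
    ring
  have hanti : AntitoneOn E (Ici 0) := by
    refine antitoneOn_of_deriv_nonpos (convex_Ici 0)
      (fun r _ => (hEd r).continuousAt.continuousWithinAt)
      (fun r _ => (hEd r).differentiableAt.differentiableWithinAt) fun r _ => ?_
    rw [(hEd r).deriv]
    have : (0 : ℝ) ≤ (2 * m + 1) * bes (m + 1) (-r) ^ 2 := by positivity
    linarith
  have h0 : E s ≤ E 0 := hanti (mem_Ici.mpr le_rfl) hs hs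
  have hE0 : E 0 ≤ 1 := by
    simp only [hE, neg_zero, bes_zero, zero_mul, zero_add]
    have : (1 : ℝ) ≤ (m ! : ℝ) := by exact_mod_cast Nat.factorial_pos m
    have h3 : 1 / (m ! : ℝ) ≤ 1 := by rw [div_le_one (by positivity)]; exact this
    exact pow_le_one₀ (by positivity) h3
  have hsq : bes m (-s) ^ 2 ≤ 1 := by
    have : 0 ≤ s * bes (m + 1) (-s) ^ 2 := by positivity
    simp only [hE] at h0 hE0
    linarith
  exact abs_le_one_iff_mul_self_le_one.mpr (by nlinarith)

end

/-! ### Inner products and dominated convergence in `L²` -/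

theorem integral_zero_eq_Ioo {L : ℝ} (hL : 0 ≤ L) (f : ℝ → ℝ) :
    ∫ y in 0..L, f y = ∫ y in Ioo 0 L, f y := by
  rw [intervalIntegral.integral_of_le hL, integral_Ioc_eq_integral_Ioo]

theorem inner_toLp {μ : Measure ℝ} {f g : ℝ → ℝ} (hf : MemLp f 2 μ) (hg : MemLp g 2 μ) :
    inner ℝ (hf.toLp f) (hg.toLp g) = ∫ y, f y * g y ∂μ := by
  rw [L2.inner_def]
  refine integral_congr_ae ?_
  filter_upwards [hf.coeFn_toLp, hg.coeFn_toLp] with y h1 h2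
  rw [h1, h2]
  simp [mul_comm]

theorem inner_toLp_left {μ : Measure ℝ} {f : ℝ → ℝ} (hf : MemLp f 2 μ) (u : Lp ℝ 2 μ) :
    inner ℝ (hf.toLp f) u = ∫ y, f y * u y ∂μ := by
  rw [L2.inner_def]
  refine integral_congr_ae ?_
  filter_upwards [hf.coeFn_toLp] with y h1
  rw [h1]
  simp [mul_comm]

theorem tendsto_toLp_of_dominated {ι : Type*} {l : Filter ι} [l.IsCountablyGenerated]
    {μ : Measure ℝ} [IsFiniteMeasure μ] {f : ι → ℝ → ℝ} {g : ℝ → ℝ}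
    (hf : ∀ i, MemLp (f i) 2 μ) (hg : MemLp g 2 μ) (C : ℝ)
    (hfC : ∀ᶠ i in l, ∀ᵐ y ∂μ, |f i y| ≤ C) (hgC : ∀ᵐ y ∂μ, |g y| ≤ C)
    (h : ∀ᵐ y ∂μ, Tendsto (fun i => f i y) l (𝓝 (g y))) :
    Tendsto (fun i => (hf i).toLp (f i)) l (𝓝 (hg.toLp g)) := by
  rw [tendsto_iff_norm_sub_tendsto_zero]
  have hsq : ∀ i, ‖(hf i).toLp (f i) - hg.toLp g‖ = √(∫ y, (f i y - g y) ^ 2 ∂μ) := by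
    intro i
    rw [← MemLp.toLp_sub, ← Real.sqrt_sq (norm_nonneg (((hf i).sub hg).toLp (f i - g))),
      ← real_inner_self_eq_norm_sq, inner_toLp]
    simp [sq]
  simp only [hsq]
  rw [← Real.sqrt_zero]
  refine (Real.continuous_sqrt.tendsto 0).comp ?_
  have h0 : (0 : ℝ) = ∫ _, (0 : ℝ) ∂μ := by simp
  rw [h0]
  refine tendsto_integral_filter_of_dominated_convergence (fun _ => (C + C) ^ 2) ?_ ?_
    (integrable_const _) ?_
  · exact Eventually.of_forall fun i =>
      (((hf i).aestronglyMeasurable.sub hg.aestronglyMeasurable).pow 2)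
  · filter_upwards [hfC] with i hi
    filter_upwards [hi, hgC] with y h1 h2
    rw [Real.norm_eq_abs, abs_pow]
    have := abs_sub (f i y) (g y)
    gcongr
    linarith
  · filter_upwards [h] with y hy
    simpa using (hy.sub_const (g y)).pow 2

/-! ### Functions glued along the diagonal, as curves in `L²` -/

/-- The function of `y` equal to `p x y` for `y < x` and to the constant `q x` for `x ≤ y`. -/
def glue (p : ℝ → ℝ → ℝ) (q : ℝ → ℝ) (x y : ℝ) : ℝ := if y < x then p x y else q x

theorem exists_bound_square {p : ℝ → ℝ → ℝ} (hp : Continuous (Function.uncurry p)) (M : ℝ) :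
    ∃ C, 0 ≤ C ∧ ∀ x ∈ Icc (-M) M, ∀ y ∈ Icc (-M) M, |p x y| ≤ C := by
  obtain ⟨C, hC⟩ := (isCompact_Icc.prod isCompact_Icc).exists_bound_of_continuousOn
    (s := Icc (-M) M ×ˢ Icc (-M) M) hp.continuousOn
  exact ⟨max C 0, le_max_right _ _, fun x hx y hy => (hC (x, y) ⟨hx, hy⟩).trans (le_max_left _ _)⟩

theorem exists_bound_glue {p : ℝ → ℝ → ℝ} {q : ℝ → ℝ} (hp : Continuous (Function.uncurry p))
    (hq : Continuous q) (M : ℝ) :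
    ∃ C, 0 ≤ C ∧ ∀ x ∈ Icc (-M) M, ∀ y ∈ Icc (-M) M, |glue p q x y| ≤ C := by
  obtain ⟨C, hC0, hC⟩ := exists_bound_square hp M
  obtain ⟨D, hD⟩ := isCompact_Icc.exists_bound_of_continuousOn (s := Icc (-M) M) hq.continuousOn
  refine ⟨max C D, hC0.trans (le_max_left _ _), fun x hx y hy => ?_⟩
  rw [glue]
  split_ifs
  · exact (hC x hx y hy).trans (le_max_left _ _)
  · exact (hD x hx).trans (le_max_right _ _)

theorem glue_memLp {p : ℝ → ℝ → ℝ} {q : ℝ → ℝ} (hp : Continuous (Function.uncurry p))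
    (hq : Continuous q) (L x : ℝ) : MemLp (glue p q x) 2 (volume.restrict (Ioo 0 L)) := by
  obtain ⟨C, -, hC⟩ := exists_bound_glue hp hq (max |x| L)
  refine MemLp.of_bound ?_ C ?_
  · have : Continuous (p x) := hp.comp (Continuous.prodMk_right x)
    exact (Measurable.ite measurableSet_Iio this.measurable measurable_const).aestronglyMeasurable
  · filter_upwards [ae_restrict_mem measurableSet_Ioo] with y hy
    refine hC x (abs_le.mp (le_max_left _ _)) y ⟨?_, hy.2.le.trans (le_max_right _ _)⟩
    linarith [hy.1, (abs_nonneg x).trans (le_max_left |x| L)]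

/-- The class of `glue p q x` in `L²(0, L)`. -/
def glueL2 {p : ℝ → ℝ → ℝ} {q : ℝ → ℝ} (hp : Continuous (Function.uncurry p))
    (hq : Continuous q) (L x : ℝ) : L2 L := (glue_memLp hp hq L x).toLp _

theorem coeFn_glueL2 {p : ℝ → ℝ → ℝ} {q : ℝ → ℝ} (hp : Continuous (Function.uncurry p))
    (hq : Continuous q) (L x : ℝ) :
    (glueL2 hp hq L x : ℝ → ℝ) =ᵐ[volume.restrict (Ioo 0 L)] glue p q x :=
  (glue_memLp hp hq L x).coeFn_toLp

theorem ae_ne_restrict (s : Set ℝ) (x : ℝ) : ∀ᵐ y ∂(volume.restrict s), y ≠ x :=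
  ae_restrict_of_ae (by simp [ae_iff, measure_singleton])

theorem mem_Icc_neg_of_abs_le {M x : ℝ} (h : |x| ≤ M) : x ∈ Icc (-M) M := abs_le.mp h

/-- No matching on the diagonal is needed: pointwise convergence as `x → x₀` can fail only at `y =
x₀`, and the functions are locally bounded. -/
theorem continuous_glueL2 {p : ℝ → ℝ → ℝ} {q : ℝ → ℝ} (hp : Continuous (Function.uncurry p))
    (hq : Continuous q) (L : ℝ) : Continuous (glueL2 hp hq L) := by
  refine continuous_iff_continuousAt.mpr fun x₀ => ?_
  set M := |x₀| + 1 + |L|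
  obtain ⟨C, -, hC⟩ := exists_bound_glue hp hq M
  have hy : ∀ y ∈ Ioo 0 L, y ∈ Icc (-M) M := fun y hy => mem_Icc_neg_of_abs_le (by
    rw [abs_of_pos hy.1]
    linarith [hy.2, le_abs_self L, abs_nonneg x₀])
  have hb : ∀ x, |x - x₀| ≤ 1 → ∀ᵐ y ∂(volume.restrict (Ioo 0 L)), |glue p q x y| ≤ C := by
    intro x hx
    filter_upwards [ae_restrict_mem measurableSet_Ioo] with y hyL
    refine hC x (mem_Icc_neg_of_abs_le ?_) y (hy y hyL)
    have := abs_add_le (x - x₀) x₀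
    rw [sub_add_cancel] at this
    linarith [abs_nonneg L]
  refine tendsto_toLp_of_dominated _ _ C ?_ (hb x₀ (by simp)) ?_
  · filter_upwards [Metric.ball_mem_nhds x₀ one_pos] with x hx
    exact hb x (by simpa [Real.dist_eq] using (Metric.mem_ball.mp hx).le)
  · filter_upwards [ae_ne_restrict (Ioo 0 L) x₀] with y hyx
    rcases lt_or_gt_of_ne hyx with h | h
    · have hc : Tendsto (fun x => p x y) (𝓝 x₀) (𝓝 (p x₀ y)) :=
        (hp.comp (Continuous.prodMk_left y)).tendsto x₀
      simp only [glue, if_pos h]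
      refine hc.congr' ?_
      filter_upwards [Ioi_mem_nhds h] with x hx
      rw [if_pos (mem_Ioi.mp hx)]
    · simp only [glue, if_neg h.not_gt]
      refine (hq.tendsto x₀).congr' ?_
      filter_upwards [Iio_mem_nhds h] with x hx
      rw [if_neg (not_lt.mpr (le_of_lt hx))]

/-- A formula without cases, from which a Lipschitz bound in `x` follows even when `x` crosses `y`.
-/
theorem glue_eq_max_min {f : ℝ → ℝ → ℝ} {g : ℝ → ℝ} (hfg : ∀ y, f y y = g y) (x y : ℝ) :
    glue f g x y = f (max x y) y + g (min x y) - g y := by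
  rw [glue]
  split_ifs with h
  · rw [max_eq_left h.le, min_eq_right h.le]; ring
  · rw [not_lt] at h
    rw [max_eq_right h, min_eq_left h, hfg]; ring

theorem abs_sub_le_of_hasDerivAt {f f' : ℝ → ℝ} (hf : ∀ x, HasDerivAt f (f' x) x) {M C : ℝ}
    (hC : ∀ x ∈ Icc (-M) M, |f' x| ≤ C) {x y : ℝ} (hx : x ∈ Icc (-M) M) (hy : y ∈ Icc (-M) M) :
    |f x - f y| ≤ C * |x - y| :=
  (convex_Icc (-M) M).norm_image_sub_le_of_norm_hasDerivWithin_le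
    (fun z _ => (hf z).hasDerivWithinAt) hC hy hx

/-- Because the two pieces match on the diagonal, the difference quotients are uniformly bounded by
`C + D`. They converge for every `y ≠ x₀`, so dominated convergence applies and no interface term
appears. -/
theorem hasDerivAt_glueL2 {f p : ℝ → ℝ → ℝ} {g q : ℝ → ℝ} (hfg : ∀ y, f y y = g y)
    (hf : Continuous (Function.uncurry f)) (hg : Continuous g)
    (hp : Continuous (Function.uncurry p)) (hq : Continuous q)
    (hfp : ∀ x y, HasDerivAt (fun x => f x y) (p x y) x) (hgq : ∀ x, HasDerivAt g (q x) x)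
    (L x₀ : ℝ) : HasDerivAt (glueL2 hf hg L) (glueL2 hp hq L x₀) x₀ := by
  rw [hasDerivAt_iff_tendsto_slope]
  have hm : ∀ x, MemLp (fun y => (x - x₀)⁻¹ * (glue f g x y - glue f g x₀ y)) 2
      (volume.restrict (Ioo 0 L)) := fun x =>
    ((glue_memLp hf hg L x).sub (glue_memLp hf hg L x₀)).const_mul _
  have hslope : slope (glueL2 hf hg L) x₀ = fun x => (hm x).toLp _ := by
    funext x
    rw [slope_def_module, glueL2, glueL2, ← MemLp.toLp_sub, ← MemLp.toLp_const_smul]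
    rfl
  rw [hslope]
  set M := |x₀| + 1 + |L|
  obtain ⟨C, hC0, hC⟩ := exists_bound_square hp M
  obtain ⟨E, hE0, hE⟩ := exists_bound_glue hp hq M
  obtain ⟨D, hD⟩ := isCompact_Icc.exists_bound_of_continuousOn (s := Icc (-M) M) hq.continuousOn
  have hy : ∀ y ∈ Ioo 0 L, y ∈ Icc (-M) M := fun y hy => mem_Icc_neg_of_abs_le (by
    rw [abs_of_pos hy.1]
    linarith [hy.2, le_abs_self L, abs_nonneg x₀])
  have hx : ∀ x, |x - x₀| ≤ 1 → x ∈ Icc (-M) M := fun x hx => mem_Icc_neg_of_abs_le (by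
    have := abs_add_le (x - x₀) x₀
    rw [sub_add_cancel] at this
    linarith [abs_nonneg L])
  have hmax : ∀ {a b : ℝ}, a ∈ Icc (-M) M → b ∈ Icc (-M) M → max a b ∈ Icc (-M) M :=
    fun ha hb => ⟨ha.1.trans (le_max_left _ _), max_le ha.2 hb.2⟩
  have hmin : ∀ {a b : ℝ}, a ∈ Icc (-M) M → b ∈ Icc (-M) M → min a b ∈ Icc (-M) M :=
    fun ha hb => ⟨le_min ha.1 hb.1, (min_le_left _ _).trans ha.2⟩
  have hx₀ : x₀ ∈ Icc (-M) M := hx x₀ (by simp)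
  have hD0 : 0 ≤ D := (norm_nonneg _).trans (hD x₀ hx₀)
  refine tendsto_toLp_of_dominated hm _ (max E (C + D)) ?_ ?_ ?_
  · filter_upwards [nhdsWithin_le_nhds (Metric.ball_mem_nhds x₀ one_pos), self_mem_nhdsWithin]
      with x hxb hne
    have hx1 := hx x (by simpa [Real.dist_eq] using (Metric.mem_ball.mp hxb).le)
    have hpos : 0 < |x - x₀| := abs_pos.mpr (sub_ne_zero.mpr hne)
    filter_upwards [ae_restrict_mem measurableSet_Ioo] with y hyL
    have hy1 := hy y hyL
    have h1 := abs_sub_le_of_hasDerivAt (fun x => hfp x y) (fun x hx => hC x hx y hy1)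
      (hmax hx1 hy1) (hmax hx₀ hy1)
    have h2 := abs_sub_le_of_hasDerivAt hgq hD (hmin hx1 hy1) (hmin hx₀ hy1)
    have h3 : |max x y - max x₀ y| ≤ |x - x₀| := abs_max_sub_max_le_abs _ _ _
    have h4 : |min x y - min x₀ y| ≤ |x - x₀| := by
      simpa using abs_min_sub_min_le_max x y x₀ y
    refine le_trans ?_ (le_max_right _ _)
    rw [abs_mul, abs_inv, inv_mul_le_iff₀ hpos, glue_eq_max_min hfg, glue_eq_max_min hfg]
    have h5 := abs_add_le (f (max x y) y - f (max x₀ y) y) (g (min x y) - g (min x₀ y))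
    have h6 : f (max x y) y + g (min x y) - g y - (f (max x₀ y) y + g (min x₀ y) - g y)
      = (f (max x y) y - f (max x₀ y) y) + (g (min x y) - g (min x₀ y)) := by ring
    rw [h6]
    have h7 := mul_le_mul_of_nonneg_left h3 hC0
    have h8 := mul_le_mul_of_nonneg_left h4 hD0
    linarith
  · filter_upwards [ae_restrict_mem measurableSet_Ioo] with y hyL
    exact (hE x₀ hx₀ y (hy y hyL)).trans (le_max_left _ _)
  · filter_upwards [ae_ne_restrict (Ioo 0 L) x₀] with y hyx
    rcases lt_or_gt_of_ne hyx with h | h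
    · have hc := hasDerivAt_iff_tendsto_slope.mp (hfp x₀ y)
      rw [slope_fun_def_field] at hc
      simp only [glue, if_pos h]
      refine hc.congr' ?_
      filter_upwards [nhdsWithin_le_nhds (Ioi_mem_nhds h)] with x hx
      rw [if_pos (mem_Ioi.mp hx)]
      ring
    · have hc := hasDerivAt_iff_tendsto_slope.mp (hgq x₀)
      rw [slope_fun_def_field] at hc
      simp only [glue, if_neg h.not_gt]
      refine hc.congr' ?_
      filter_upwards [nhdsWithin_le_nhds (Iio_mem_nhds h)] with x hx
      rw [if_neg (not_lt.mpr (le_of_lt hx))]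
      ring

/-! ### Integration by parts and weak derivatives in one dimension -/

/-- Integration by parts for absolutely continuous functions, since `g` is only integrable. The free
constant `c` is meant to be the value at `0` of an `H¹` function with derivative `g`. -/
theorem integral_mul_eq_sub_integral_deriv_mul {f f' g : ℝ → ℝ} {x : ℝ}
    (hf : ∀ y, HasDerivAt f (f' y) y) (hf' : Continuous f')
    (hg : IntervalIntegrable g volume 0 x) (c : ℝ) :
    ∫ y in 0..x, f y * g y = f x * (c + ∫ t in 0..x, g t) - f 0 * c
      - ∫ y in 0..x, f' y * (c + ∫ t in 0..y, g t) := by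
  have hderiv : deriv f = f' := funext fun y => (hf y).deriv
  have hfc : ContDiff ℝ 1 f := contDiff_one_iff_deriv.mpr
    ⟨fun y => (hf y).differentiableAt, by rwa [hderiv]⟩
  have hfa : AbsolutelyContinuousOnInterval f 0 x :=
    hfc.contDiffOn.absolutelyContinuousOnInterval
  have hga := hg.absolutelyContinuousOnInterval_intervalIntegral (c := 0) left_mem_uIcc
  have h := hfa.integral_mul_deriv_eq_deriv_mul hga
  have e1 : ∫ y in 0..x, f y * deriv (fun y => ∫ t in 0..y, g t) y
      = ∫ y in 0..x, f y * g y := by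
    refine intervalIntegral.integral_congr_ae ?_
    filter_upwards [hg.ae_hasDerivAt_integral] with y hy hyx
    rw [(hy (uIoc_subset_uIcc hyx) 0 left_mem_uIcc).deriv]
  have e2 : ∫ y in 0..x, f' y * (c + ∫ t in 0..y, g t)
      = (f x - f 0) * c + ∫ y in 0..x, f' y * ∫ t in 0..y, g t := by
    have h1 : IntervalIntegrable (fun y => f' y * c) volume 0 x :=
      (hf'.mul continuous_const).intervalIntegrable _ _
    have h2 : IntervalIntegrable (fun y => f' y * ∫ t in 0..y, g t) volume 0 x :=
      (hf'.continuousOn.mul hga.continuousOn).intervalIntegrable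
    simp only [mul_add]
    rw [intervalIntegral.integral_add h1 h2, intervalIntegral.integral_mul_const,
      intervalIntegral.integral_eq_sub_of_hasDerivAt (fun y _ => hf y)
        (hf'.intervalIntegrable _ _)]
  rw [e1, hderiv] at h
  rw [h, e2]
  simp
  ring

theorem L2.integrableOn {L : ℝ} (g : L2 L) : IntegrableOn g (Ioo 0 L) :=
  (Lp.memLp g).integrable one_le_two

theorem L2.intervalIntegrable {L x : ℝ} (g : L2 L) (hx : x ∈ Icc 0 L) :
    IntervalIntegrable g volume 0 x := by
  rw [intervalIntegrable_iff_integrableOn_Ioo_of_le hx.1]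
  exact (L2.integrableOn g).mono_set (Ioo_subset_Ioo_right hx.2)

theorem continuousOn_primitive_L2 {L : ℝ} (hL : 0 ≤ L) (g : L2 L) :
    ContinuousOn (fun y => ∫ t in 0..y, g t) (Icc 0 L) := by
  have := (L2.intervalIntegrable g (right_mem_Icc.mpr
    hL)).absolutelyContinuousOnInterval_intervalIntegral (c := 0) left_mem_uIcc
  simpa [uIcc_of_le hL] using this.continuousOn

theorem IsTestFunction.hasDerivAt {L : ℝ} {φ : ℝ → ℝ} (h : IsTestFunction L φ) (y : ℝ) :
    HasDerivAt φ (deriv φ y) y :=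
  (h.smooth.differentiable (by simp) y).hasDerivAt

theorem IsTestFunction.eq_zero_of_notMem {L : ℝ} {φ : ℝ → ℝ} (h : IsTestFunction L φ) {y : ℝ}
    (hy : y ∉ Ioo 0 L) : φ y = 0 :=
  image_eq_zero_of_notMem_tsupport fun hy' => hy (h.support hy')

theorem integral_primitive_mul_deriv {L : ℝ} (hL : 0 ≤ L) (g : L2 L) (c : ℝ) {φ : ℝ → ℝ}
    (h : IsTestFunction L φ) :
    ∫ y in Ioo 0 L, (c + ∫ t in 0..y, g t) * deriv φ y = - ∫ y in Ioo 0 L, g y * φ y := by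
  have := integral_mul_eq_sub_integral_deriv_mul h.hasDerivAt (h.smooth.continuous_deriv (by simp))
    (L2.intervalIntegrable g (right_mem_Icc.mpr hL)) c
  rw [h.eq_zero_of_notMem (y := L) (by simp), h.eq_zero_of_notMem (y := 0) (by simp),
    integral_zero_eq_Ioo hL, integral_zero_eq_Ioo hL (fun y => deriv φ y * _)] at this
  simp only [mul_comm (φ _), mul_comm (deriv φ _)] at this
  rw [this]
  simp

theorem hasWeakDeriv_of_primitive {L : ℝ} (hL : 0 ≤ L) {f g : L2 L} {c : ℝ}
    (h : (f : ℝ → ℝ) =ᵐ[volume.restrict (Ioo 0 L)] fun y => c + ∫ t in 0..y, g t) :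
    HasWeakDeriv L f g := by
  intro φ hφ
  rw [← integral_primitive_mul_deriv hL g c hφ]
  refine integral_congr_ae ?_
  filter_upwards [h] with y hy
  rw [hy]

theorem ae_eq_zero_of_forall_test {L : ℝ} {h : ℝ → ℝ} (hh : IntegrableOn h (Ioo 0 L))
    (h0 : ∀ φ, IsTestFunction L φ → ∫ y in Ioo 0 L, h y * φ y = 0) :
    ∀ᵐ y ∂(volume.restrict (Ioo 0 L)), h y = 0 := by
  rw [ae_restrict_iff' measurableSet_Ioo]
  refine isOpen_Ioo.ae_eq_zero_of_integral_contDiff_smul_eq_zero hh.locallyIntegrableOn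
    fun g hg hgc hgs => ?_
  have := h0 g ⟨hg, hgc, hgs⟩
  rw [← this, ← integral_indicator measurableSet_Ioo]
  refine integral_congr_ae (Eventually.of_forall fun y => ?_)
  by_cases hy : y ∈ Ioo 0 L
  · simp [indicator_of_mem hy, mul_comm]
  · have : g y = 0 := image_eq_zero_of_notMem_tsupport fun hy' => hy (hgs hy')
    simp [this, indicator_of_notMem hy]

theorem exists_test_integral_one {L : ℝ} (hL : 0 < L) :
    ∃ ρ, IsTestFunction L ρ ∧ ∫ y in Ioo 0 L, ρ y = 1 := by
  let b : ContDiffBump (L / 2) := ⟨L / 8, L / 4, by positivity, by linarith⟩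
  have hs : tsupport (b.normed volume) ⊆ Ioo 0 L := by
    rw [b.tsupport_normed_eq, Real.closedBall_eq_Icc]
    intro y hy
    simp only [b, mem_Icc] at hy
    constructor <;> linarith [hy.1, hy.2]
  refine ⟨b.normed volume, ⟨b.contDiff_normed, b.hasCompactSupport_normed, hs⟩, ?_⟩
  rw [setIntegral_eq_integral_of_forall_compl_eq_zero, b.integral_normed]
  exact fun y hy => image_eq_zero_of_notMem_tsupport fun hy' => hy (hs hy')

/-- The primitive from `0` vanishes to the left of the support of `ψ`, and to the right of it
because the total integral is zero. -/
theorem IsTestFunction.exists_primitive {L : ℝ} (hL : 0 < L) {ψ : ℝ → ℝ} (h : IsTestFunction L ψ)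
    (h0 : ∫ y in Ioo 0 L, ψ y = 0) : ∃ φ, IsTestFunction L φ ∧ deriv φ = ψ := by
  have hc := h.smooth.continuous
  have hd : ∀ y, HasDerivAt (fun y => ∫ t in 0..y, ψ t) (ψ y) y := fun y =>
    intervalIntegral.integral_hasDerivAt_right (hc.intervalIntegrable _ _)
      hc.stronglyMeasurable.stronglyMeasurableAtFilter hc.continuousAt
  have hderiv : deriv (fun y => ∫ t in 0..y, ψ t) = ψ := funext fun y => (hd y).deriv
  obtain ⟨α, β, hα, hβ, hαβ⟩ : ∃ α β, 0 < α ∧ β < L ∧ tsupport ψ ⊆ Icc α β := by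
    rcases (tsupport ψ).eq_empty_or_nonempty with he | hne
    -- With empty support the choice `α = L`, `β = 0` makes `Icc α β` empty.
    · exact ⟨L, 0, hL, hL, by simp [he]⟩
    · obtain ⟨α, hα⟩ := (show IsCompact (tsupport ψ) from h.compact).exists_isLeast hne
      obtain ⟨β, hβ⟩ := (show IsCompact (tsupport ψ) from h.compact).exists_isGreatest hne
      exact ⟨α, β, (h.support hα.1).1, (h.support hβ.1).2, fun y hy => ⟨hα.2 hy, hβ.2 hy⟩⟩
  have hz : ∀ y ∉ Icc α β, ψ y = 0 := fun y hy =>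
    image_eq_zero_of_notMem_tsupport fun hy' => hy (hαβ hy')
  have hts : tsupport (fun y => ∫ t in 0..y, ψ t) ⊆ Icc α β := by
    refine closure_minimal (fun y hy => ?_) isClosed_Icc
    by_contra hny
    refine hy ?_
    simp only [mem_Icc, not_and_or, not_le] at hny
    rcases hny with hny | hny
    · refine (intervalIntegral.integral_congr (g := fun _ => 0) fun t ht => ?_).trans (by simp)
      refine hz t fun ht' => ?_
      rcases le_max_iff.mp (show t ≤ max 0 y from ht.2) with h1 | h1 <;> linarith [ht'.1]
    · have e := intervalIntegral.integral_interval_sub_left (μ := volume)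
        (hc.intervalIntegrable 0 L) (hc.intervalIntegrable 0 y)
      rw [integral_zero_eq_Ioo hL.le, h0, zero_sub] at e
      have e2 : ∫ t in y..L, ψ t = 0 := by
        refine (intervalIntegral.integral_congr (g := fun _ => 0) fun t ht => ?_).trans (by simp)
        refine hz t fun ht' => ?_
        rcases min_le_iff.mp (show min y L ≤ t from ht.1) with h1 | h1 <;> linarith [ht'.2]
      change ∫ t in 0..y, ψ t = 0
      linarith
  refine ⟨fun y => ∫ t in 0..y, ψ t, ⟨?_, ?_, ?_⟩, hderiv⟩
  · rw [contDiff_infty_iff_deriv, hderiv]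
    exact ⟨fun y => (hd y).differentiableAt, h.smooth⟩
  · exact isCompact_Icc.of_isClosed_subset (isClosed_tsupport _) hts
  · exact hts.trans fun y hy => ⟨hα.trans_le hy.1, hy.2.trans_lt hβ⟩

theorem IsTestFunction.sub_const_mul {L : ℝ} {ψ ρ : ℝ → ℝ} (hψ : IsTestFunction L ψ)
    (hρ : IsTestFunction L ρ) (c : ℝ) : IsTestFunction L fun y => ψ y - c * ρ y := by
  have h : tsupport (fun y => ψ y - c * ρ y) ⊆ tsupport ψ ∪ tsupport ρ := by
    refine closure_minimal (fun y hy => ?_) ((isClosed_tsupport _).union (isClosed_tsupport _))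
    by_contra hn
    simp only [mem_union, not_or] at hn
    exact hy (by simp [image_eq_zero_of_notMem_tsupport hn.1,
      image_eq_zero_of_notMem_tsupport hn.2])
  refine ⟨hψ.smooth.sub (contDiff_const.mul hρ.smooth), ?_,
    h.trans (union_subset hψ.support hρ.support)⟩
  exact (IsCompact.union hψ.compact hρ.compact).of_isClosed_subset (isClosed_tsupport _) h

theorem IsTestFunction.integrable {L : ℝ} {ψ : ℝ → ℝ} (hψ : IsTestFunction L ψ) (s : Set ℝ) :
    Integrable ψ (volume.restrict s) :=
  (hψ.smooth.continuous.integrable_of_hasCompactSupport hψ.compact).restrict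

/-- An integrable function with vanishing weak derivative is constant. -/
theorem ae_eq_const_of_forall_test {L : ℝ} (hL : 0 < L) {h : ℝ → ℝ}
    (hh : MemLp h 2 (volume.restrict (Ioo 0 L)))
    (h0 : ∀ φ, IsTestFunction L φ → ∫ y in Ioo 0 L, h y * deriv φ y = 0) :
    ∃ c, ∀ᵐ y ∂(volume.restrict (Ioo 0 L)), h y = c := by
  obtain ⟨ρ, hρ, hρ1⟩ := exists_test_integral_one hL
  set c := ∫ y in Ioo 0 L, h y * ρ y
  have hi : IntegrableOn h (Ioo 0 L) := hh.integrable one_le_two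
  refine ⟨c, (ae_eq_zero_of_forall_test (h := fun y => h y - c)
    (hi.sub (integrable_const c)) fun ψ hψ => ?_).mono fun y hy => sub_eq_zero.mp hy⟩
  set d := ∫ y in Ioo 0 L, ψ y
  -- Subtracting `d ρ` makes the mean zero, so `ψ - d ρ` is the derivative of a test function.
  have hψρ := hψ.sub_const_mul hρ d
  obtain ⟨φ, hφ, hφ'⟩ := hψρ.exists_primitive hL (by
    rw [integral_sub (hψ.integrable _) ((hρ.integrable _).const_mul d), integral_const_mul, hρ1]
    simp [d])
  have h1 := h0 φ hφ
  have i1 : Integrable (fun y => h y * ψ y) (volume.restrict (Ioo 0 L)) :=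
    hh.integrable_mul hψ.memLp
  have i2 : Integrable (fun y => h y * ρ y) (volume.restrict (Ioo 0 L)) :=
    hh.integrable_mul hρ.memLp
  have e1 : ∀ y, h y * deriv φ y = h y * ψ y - d * (h y * ρ y) := fun y => by
    rw [hφ']; ring
  simp only [e1] at h1
  rw [integral_sub i1 (i2.const_mul d), integral_const_mul] at h1
  simp only [sub_mul]
  rw [integral_sub i1 ((hψ.integrable _).const_mul c), integral_const_mul]
  linarith [mul_comm c d]

theorem memLp_primitive {L : ℝ} (hL : 0 ≤ L) (g : L2 L) (c : ℝ) :
    MemLp (fun y => c + ∫ t in 0..y, g t) 2 (volume.restrict (Ioo 0 L)) := by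
  have hc : ContinuousOn (fun y => c + ∫ t in 0..y, g t) (Icc 0 L) :=
    continuousOn_const.add (continuousOn_primitive_L2 hL g)
  obtain ⟨C, hC⟩ := isCompact_Icc.exists_bound_of_continuousOn hc
  refine MemLp.of_bound ((hc.mono Ioo_subset_Icc_self).aestronglyMeasurable measurableSet_Ioo) C ?_
  filter_upwards [ae_restrict_mem measurableSet_Ioo] with y hy
  exact hC y (Ioo_subset_Icc_self hy)

/-- An element of `H¹(0, L)` is almost everywhere equal to a primitive of its weak derivative. -/
theorem HasWeakDeriv.exists_primitive {L : ℝ} (hL : 0 < L) {f g : L2 L} (h : HasWeakDeriv L f g) :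
    ∃ c, (f : ℝ → ℝ) =ᵐ[volume.restrict (Ioo 0 L)] fun y => c + ∫ t in 0..y, g t := by
  have hm := memLp_primitive hL.le g 0
  obtain ⟨c, hc⟩ := ae_eq_const_of_forall_test hL ((Lp.memLp f).sub hm) fun φ hφ => by
    have h1 := h φ hφ
    have h2 := integral_primitive_mul_deriv hL.le g 0 hφ
    simp only [Pi.sub_apply, sub_mul]
    have i1 : Integrable (fun y => f y * deriv φ y) (volume.restrict (Ioo 0 L)) :=
      (Lp.memLp f).integrable_mul hφ.deriv_memLp
    have i2 : Integrable (fun y => (0 + ∫ t in 0..y, g t) * deriv φ y)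
        (volume.restrict (Ioo 0 L)) := hm.integrable_mul hφ.deriv_memLp
    rw [integral_sub i1 i2, h1, h2, sub_self]
  refine ⟨c, hc.mono fun y hy => ?_⟩
  simp only [Pi.sub_apply, zero_add] at hy
  linarith

theorem HasWeakDeriv.unique {L : ℝ} {f g g' : L2 L} (h : HasWeakDeriv L f g)
    (h' : HasWeakDeriv L f g') : g = g' := by
  refine Lp.ext ?_
  have := ae_eq_zero_of_forall_test (L := L) (h := fun y => g y - g' y)
    ((L2.integrableOn g).sub (L2.integrableOn g')) fun φ hφ => by
      have h1 := h φ hφ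
      have h2 := h' φ hφ
      simp only [sub_mul]
      have i1 : Integrable (fun y => g y * φ y) (volume.restrict (Ioo 0 L)) :=
        (Lp.memLp g).integrable_mul hφ.memLp
      have i2 : Integrable (fun y => g' y * φ y) (volume.restrict (Ioo 0 L)) :=
        (Lp.memLp g').integrable_mul hφ.memLp
      rw [integral_sub i1 i2]
      linarith
  exact this.mono fun y hy => sub_eq_zero.mp hy

/-- The element of `H¹(0, L)` with given function and weak derivative. -/
def H1.mk {L : ℝ} {f g : L2 L} (h : HasWeakDeriv L f g) : H1 L :=
  ⟨WithLp.toLp 2 (f, g), h⟩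

@[simp] theorem H1.toL2_mk {L : ℝ} {f g : L2 L} (h : HasWeakDeriv L f g) :
    H1.toL2 L (H1.mk h) = f := rfl

theorem H1.hasWeakDeriv {L : ℝ} (v : H1 L) : HasWeakDeriv L (H1.toL2 L v) (H1.weakDeriv L v) :=
  v.2

theorem H1.exists_primitive {L : ℝ} (hL : 0 < L) (v : H1 L) :
    ∃ c, (H1.toL2 L v : ℝ → ℝ) =ᵐ[volume.restrict (Ioo 0 L)]
      fun y => c + ∫ t in 0..y, H1.weakDeriv L v t :=
  (H1.hasWeakDeriv v).exists_primitive hL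

theorem memLp_of_continuous {f : ℝ → ℝ} (hf : Continuous f) (L : ℝ) :
    MemLp f 2 (volume.restrict (Ioo 0 L)) := by
  obtain ⟨C, hC⟩ := isCompact_Icc.exists_bound_of_continuousOn (s := Icc 0 L) hf.continuousOn
  refine MemLp.of_bound hf.aestronglyMeasurable C ?_
  filter_upwards [ae_restrict_mem measurableSet_Ioo] with y hy
  exact hC y (Ioo_subset_Icc_self hy)

theorem hasWeakDeriv_toLp {L : ℝ} (hL : 0 ≤ L) {f g : ℝ → ℝ}
    (hf : MemLp f 2 (volume.restrict (Ioo 0 L))) (hg : MemLp g 2 (volume.restrict (Ioo 0 L)))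
    {c : ℝ} (h : ∀ y ∈ Ioo 0 L, f y = c + ∫ t in 0..y, g t) :
    HasWeakDeriv L (hf.toLp f) (hg.toLp g) := by
  refine hasWeakDeriv_of_primitive hL (c := c) ?_
  filter_upwards [hf.coeFn_toLp, ae_restrict_mem measurableSet_Ioo] with y hy hyL
  rw [hy, h y hyL]
  congr 1
  refine intervalIntegral.integral_congr_ae ?_
  have := (ae_restrict_iff' measurableSet_Ioo).mp hg.coeFn_toLp
  filter_upwards [this] with t ht hty
  rw [uIoc_of_le hyL.1.le] at hty
  exact (ht ⟨hty.1, hty.2.trans_lt hyL.2⟩).symm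

/-- The restriction of a `C¹` function to `(0, L)`. -/
def H1.ofDeriv {L : ℝ} (hL : 0 ≤ L) {f f' : ℝ → ℝ} (hf : ∀ y, HasDerivAt f (f' y) y)
    (hf' : Continuous f') : H1 L :=
  H1.mk (hasWeakDeriv_toLp (c := f 0) hL
    (memLp_of_continuous (continuous_iff_continuousAt.mpr fun y => (hf y).continuousAt) L)
    (memLp_of_continuous hf' L) fun y _ => by
      rw [intervalIntegral.integral_eq_sub_of_hasDerivAt (fun y _ => hf y)
        (hf'.intervalIntegrable _ _)]
      ring)

theorem H1.toL2_ofDeriv {L : ℝ} (hL : 0 ≤ L) {f f' : ℝ → ℝ} (hf : ∀ y, HasDerivAt f (f' y) y)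
    (hf' : Continuous f') :
    (H1.toL2 L (H1.ofDeriv hL hf hf') : ℝ → ℝ) =ᵐ[volume.restrict (Ioo 0 L)] f :=
  (memLp_of_continuous (continuous_iff_continuousAt.mpr fun y => (hf y).continuousAt)
    L).coeFn_toLp

theorem H1.weakDeriv_ofDeriv {L : ℝ} (hL : 0 ≤ L) {f f' : ℝ → ℝ}
    (hf : ∀ y, HasDerivAt f (f' y) y) (hf' : Continuous f') :
    (H1.weakDeriv L (H1.ofDeriv hL hf hf') : ℝ → ℝ) =ᵐ[volume.restrict (Ioo 0 L)] f' :=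
  (memLp_of_continuous hf' L).coeFn_toLp

/-! ### Integrals with a parameter and point values on `H¹` -/

theorem hasDerivAt_primitive {E : Type*} [NormedAddCommGroup E] [NormedSpace ℝ E] [CompleteSpace E]
    {f : ℝ → E} (hf : Continuous f) (x : ℝ) :
    HasDerivAt (fun x => ∫ t in 0..x, f t) (f x) x :=
  intervalIntegral.integral_hasDerivAt_right (hf.intervalIntegrable _ _)
    hf.stronglyMeasurable.stronglyMeasurableAtFilter hf.continuousAt

theorem eq_add_integral_of_apply {E : Type*} [NormedAddCommGroup E] [NormedSpace ℝ E]
    {F R : ℝ → StrongDual ℝ E} (hR : Continuous R) {s : ℝ}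
    (h : ∀ v, F s v = F 0 v + ∫ r in 0..s, R r v) : F s = F 0 + ∫ r in 0..s, R r := by
  ext v
  rw [_root_.add_apply, ContinuousLinearMap.intervalIntegral_apply (hR.intervalIntegrable _ _), h]

theorem continuous_uncurry_zero : Continuous (Function.uncurry fun _ _ : ℝ => (0 : ℝ)) :=
  continuous_const

theorem continuous_section {p : ℝ → ℝ → ℝ} (hp : Continuous (Function.uncurry p)) (x : ℝ) :
    Continuous (p x) := hp.comp (Continuous.prodMk_right x)

theorem continuous_diag {p : ℝ → ℝ → ℝ} (hp : Continuous (Function.uncurry p)) :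
    Continuous fun x => p x x := hp.comp (continuous_id.prodMk continuous_id)

theorem continuous_integral_diag {p : ℝ → ℝ → ℝ} (hp : Continuous (Function.uncurry p)) :
    Continuous fun x => ∫ y in 0..x, p x y :=
  intervalIntegral.continuous_parametric_intervalIntegral_of_continuous hp continuous_id

/-- Differentiation of an integral whose upper limit and integrand depend on a parameter. -/
theorem hasDerivAt_integral_diag {f fx : ℝ → ℝ → ℝ} (hf : Continuous (Function.uncurry f))
    (hfx : Continuous (Function.uncurry fx))
    (hd : ∀ x y, HasDerivAt (fun x => f x y) (fx x y) x) (x : ℝ) :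
    HasDerivAt (fun x => ∫ y in 0..x, f x y) (f x x + ∫ y in 0..x, fx x y) x := by
  have d1 : ∀ x t : ℝ, HasDerivAt (fun x => ∫ y in 0..t, f x y) (∫ y in 0..t, fx x y) x := by
    intro x t
    obtain ⟨C, -, hC⟩ := exists_bound_square hfx (max (|x| + 1) |t|)
    refine (intervalIntegral.hasDerivAt_integral_of_dominated_loc_of_deriv_le (F := f) (F' := fx)
      (bound := fun _ => C) (Metric.ball_mem_nhds x one_pos) ?_
      ((continuous_section hf x).intervalIntegrable _ _)
      (continuous_section hfx x).aestronglyMeasurable ?_ intervalIntegrable_const ?_).2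
    · exact Eventually.of_forall fun z => (continuous_section hf z).aestronglyMeasurable
    · refine Eventually.of_forall fun y hy z hz => hC z (mem_Icc_neg_of_abs_le ?_) y
        (mem_Icc_neg_of_abs_le ?_)
      · have h1 : |z - x| < 1 := by simpa [Real.dist_eq] using hz
        have := abs_add_le (z - x) x
        rw [sub_add_cancel] at this
        exact le_trans (by linarith) (le_max_left _ _)
      · have h1 := abs_sub_left_of_mem_uIcc (uIoc_subset_uIcc hy)
        simp only [sub_zero] at h1
        exact h1.trans (le_max_right _ _)
    · exact Eventually.of_forall fun y _ z _ => hd z y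
  have d2 : ∀ x t : ℝ, HasDerivAt (fun t => ∫ y in 0..t, f x y) (f x t) t := fun x t =>
    hasDerivAt_primitive (continuous_section hf x) t
  have hprim : Continuous fun p : ℝ × ℝ => ∫ y in 0..p.2, fx p.1 y :=
    intervalIntegral.continuous_parametric_primitive_of_continuous hfx
  -- The map `(x, t) ↦ ∫₀ᵗ f(x, y) dy` has continuous partial derivatives, so it is differentiable,
  -- and the chain rule along the diagonal `t = x` applies.
  have h := hasStrictFDerivAt_uncurry_coprod (𝕜 := ℝ) (u := (x, x))
    (f := fun x t => ∫ y in 0..t, f x y)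
    (f₁ := fun x t => ContinuousLinearMap.toSpanSingleton ℝ (∫ y in 0..t, fx x y))
    (f₂ := fun x t => ContinuousLinearMap.toSpanSingleton ℝ (f x t))
    (Eventually.of_forall fun v => (d1 v.1 v.2).hasFDerivAt)
    (Eventually.of_forall fun v => (d2 v.1 v.2).hasFDerivAt)
    ((ContinuousLinearMap.toSpanSingletonCLE (𝕜 := ℝ) (E := ℝ)).continuous.comp
      hprim).continuousAt
    ((ContinuousLinearMap.toSpanSingletonCLE (𝕜 := ℝ) (E := ℝ)).continuous.comp
      hf).continuousAt
  have h' : HasFDerivAt (fun p : ℝ × ℝ => ∫ y in 0..p.2, f p.1 y) _ (x, x) := h.hasFDerivAt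
  refine (h'.comp_hasDerivAt (f := fun x => (x, x)) x
    ((hasDerivAt_id' x).prodMk (hasDerivAt_id' x))).congr_deriv ?_
  simp [Function.HasUncurry.uncurry]
  ring

theorem integral_glue_mul {p : ℝ → ℝ → ℝ} (hp : Continuous (Function.uncurry p)) (q : ℝ → ℝ)
    {v : ℝ → ℝ} {s L : ℝ} (hs : s ∈ Icc 0 L) (hv : IntervalIntegrable v volume 0 L) :
    ∫ y in 0..L, glue p q s y * v y
      = (∫ y in 0..s, p s y * v y) + q s * ∫ y in s..L, v y := by
  have hL : 0 ≤ L := hs.1.trans hs.2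
  have hv1 : IntervalIntegrable v volume 0 s :=
    hv.mono_set (by rw [uIcc_of_le hs.1, uIcc_of_le hL]; exact Icc_subset_Icc_right hs.2)
  have hv2 : IntervalIntegrable v volume s L :=
    hv.mono_set (by rw [uIcc_of_le hs.2, uIcc_of_le hL]; exact Icc_subset_Icc_left hs.1)
  have e1 : ∀ᵐ y, y ∈ uIoc 0 s → p s y * v y = glue p q s y * v y := by
    have : ∀ᵐ y : ℝ, y ≠ s := by simp [ae_iff, measure_singleton]
    filter_upwards [this] with y hy hys
    rw [uIoc_of_le hs.1] at hys
    rw [glue, if_pos (lt_of_le_of_ne hys.2 hy)]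
  have e2 : ∀ᵐ y, y ∈ uIoc s L → q s * v y = glue p q s y * v y := by
    refine Eventually.of_forall fun y hys => ?_
    rw [uIoc_of_le hs.2] at hys
    rw [glue, if_neg hys.1.not_gt]
  have i1 : IntervalIntegrable (fun y => glue p q s y * v y) volume 0 s :=
    (hv1.continuousOn_mul (continuous_section hp s).continuousOn).congr_ae
      ((ae_restrict_iff' measurableSet_uIoc).mpr e1)
  have i2 : IntervalIntegrable (fun y => glue p q s y * v y) volume s L :=
    (hv2.const_mul (q s)).congr_ae ((ae_restrict_iff' measurableSet_uIoc).mpr e2)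
  rw [← intervalIntegral.integral_add_adjacent_intervals i1 i2,
    ← intervalIntegral.integral_congr_ae e1, ← intervalIntegral.integral_congr_ae e2,
    intervalIntegral.integral_const_mul]

theorem inner_glueL2 {p : ℝ → ℝ → ℝ} {q : ℝ → ℝ} (hp : Continuous (Function.uncurry p))
    (hq : Continuous q) (L x : ℝ) (u : L2 L) :
    inner ℝ (glueL2 hp hq L x) u = ∫ y in Ioo 0 L, glue p q x y * u y :=
  inner_toLp_left (glue_memLp hp hq L x) u

/-- Clamping the argument to `[0, L]` makes the absolutely continuous representative continuous on
all of `ℝ`, so that later integrands need no domain conditions. -/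
theorem H1.exists_continuous_rep {L : ℝ} (hL : 0 < L) (v : H1 L) :
    ∃ V : ℝ → ℝ, Continuous V ∧
      (∀ y ∈ Icc 0 L, V y = V 0 + ∫ t in 0..y, H1.weakDeriv L v t) ∧
      (H1.toL2 L v : ℝ → ℝ) =ᵐ[volume.restrict (Ioo 0 L)] V := by
  obtain ⟨c, hc⟩ := H1.exists_primitive hL v
  have hp := continuousOn_primitive_L2 hL.le (H1.weakDeriv L v)
  have hproj : ∀ y ∈ Icc 0 L, max 0 (min y L) = y := fun y hy => by
    rw [min_eq_left hy.2, max_eq_right hy.1]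
  refine ⟨fun y => c + ∫ t in 0..max 0 (min y L), H1.weakDeriv L v t, ?_, ?_, ?_⟩
  · refine continuous_const.add (hp.comp_continuous (f := fun y => max 0 (min y L))
      (by fun_prop) fun y => ⟨le_max_left _ _, max_le hL.le (min_le_right _ _)⟩)
  · intro y hy
    have h0 : max 0 (min 0 L) = 0 := hproj 0 ⟨le_rfl, hL.le⟩
    simp only [hproj y hy, h0, intervalIntegral.integral_same, add_zero]
  · filter_upwards [hc, ae_restrict_mem measurableSet_Ioo] with y hy hyL
    rw [hy, hproj y (Ioo_subset_Icc_self hyL)]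

/-- The value at the right endpoint, as a functional on `H¹(0, L)`. -/
def evEnd (L : ℝ) : StrongDual ℝ (H1 L) :=
  L⁻¹ • ((innerSL ℝ ((memLp_of_continuous (continuous_const (y := (1 : ℝ))) L).toLp _)).comp
    (H1.toL2 L) + (innerSL ℝ ((memLp_of_continuous continuous_id L).toLp _)).comp
      (H1.weakDeriv L))

/-- The value at the point `s`, as a functional on `H¹(0, L)`. -/
def evAt (L s : ℝ) : StrongDual ℝ (H1 L) :=
  evEnd L - (innerSL ℝ (glueL2 (p := fun _ _ => 0) (q := fun _ => 1) continuous_uncurry_zero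
    continuous_const L s)).comp (H1.weakDeriv L)

/-- Continuity in the dual norm: the glued function in `evAt` is the indicator of `y ≥ s`, which
moves continuously in `L²`. This makes the diagonal term of `∂ₓₓ` continuous with values in the dual
of `H¹`. -/
theorem continuous_evAt (L : ℝ) : Continuous (evAt L) :=
  continuous_const.sub (((innerSL ℝ).continuous.comp (continuous_glueL2 _ _ L)).clm_comp
    continuous_const)

theorem integral_toL2_eq {L : ℝ} {v : L2 L} {V : ℝ → ℝ}
    (h : (v : ℝ → ℝ) =ᵐ[volume.restrict (Ioo 0 L)] V) (f : ℝ → ℝ) {x : ℝ} (hx : x ∈ Icc 0 L) :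
    ∫ y in 0..x, f y * v y = ∫ y in 0..x, f y * V y := by
  rw [integral_zero_eq_Ioo hx.1, integral_zero_eq_Ioo hx.1]
  refine integral_congr_ae ?_
  filter_upwards [ae_restrict_of_ae_restrict_of_subset (Ioo_subset_Ioo_right hx.2) h] with y hy
  rw [hy]

/-- Integrating `(y v)'` over `(0, L)` gives `L v(L) = ∫ v + ∫ y v'`; the right side is visibly
bounded on `H¹`. -/
theorem evEnd_apply {L : ℝ} (hL : 0 < L) {v : H1 L} {V : ℝ → ℝ}
    (hV : ∀ y ∈ Icc 0 L, V y = V 0 + ∫ t in 0..y, H1.weakDeriv L v t)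
    (hvV : (H1.toL2 L v : ℝ → ℝ) =ᵐ[volume.restrict (Ioo 0 L)] V) : evEnd L v = V L := by
  have hL' : L ∈ Icc 0 L := right_mem_Icc.mpr hL.le
  have e : ∫ y in 0..L, y * H1.weakDeriv L v y = L * V L - ∫ y in 0..L, V y := by
    rw [integral_mul_eq_sub_integral_deriv_mul (f := fun y => y) (f' := fun _ => 1)
      (fun y => hasDerivAt_id y) continuous_const (L2.intervalIntegrable _ hL') (V 0), ← hV L hL']
    simp only [zero_mul, sub_zero, one_mul]
    congr 1
    refine intervalIntegral.integral_congr fun y hy => ?_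
    rw [uIcc_of_le hL.le] at hy
    exact (hV y hy).symm
  have e1 := integral_toL2_eq hvV (fun _ => 1) hL'
  simp only [one_mul] at e1
  simp only [evEnd, _root_.smul_apply, _root_.add_apply,
    ContinuousLinearMap.comp_apply, innerSL_apply_apply, inner_toLp_left, id, one_mul]
  rw [← integral_zero_eq_Ioo hL.le, ← integral_zero_eq_Ioo hL.le, e, e1, smul_eq_mul,
    add_sub_cancel, inv_mul_cancel_left₀ hL.ne']

theorem evAt_apply {L : ℝ} (hL : 0 < L) {v : H1 L} {V : ℝ → ℝ}
    (hV : ∀ y ∈ Icc 0 L, V y = V 0 + ∫ t in 0..y, H1.weakDeriv L v t)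
    (hvV : (H1.toL2 L v : ℝ → ℝ) =ᵐ[volume.restrict (Ioo 0 L)] V) {s : ℝ} (hs : s ∈ Icc 0 L) :
    evAt L s v = V s := by
  have hL' : L ∈ Icc 0 L := right_mem_Icc.mpr hL.le
  have hi := L2.intervalIntegrable (H1.weakDeriv L v) hL'
  have e : inner ℝ (glueL2 (p := fun _ _ => 0) (q := fun _ => 1) continuous_uncurry_zero
      continuous_const L s) (H1.weakDeriv L v) = ∫ y in s..L, H1.weakDeriv L v y := by
    rw [inner_glueL2, ← integral_zero_eq_Ioo hL.le,
      integral_glue_mul continuous_uncurry_zero _ hs hi]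
    simp
  have e2 := intervalIntegral.integral_interval_sub_left hi (L2.intervalIntegrable _ hs)
  rw [evAt, _root_.sub_apply, evEnd_apply hL hV hvV, ContinuousLinearMap.comp_apply,
    innerSL_apply_apply, e, hV L hL', hV s hs]
  linarith

/-! ### Classical kernels are weak solutions -/

/-- A smooth kernel on the plane, with its partial derivatives, solving
`∂ₓₓk - ∂_yy k = a k`, `∂_y k(x, 0) = 0`, `k(x, x) = -(b/2) x`. -/
structure IsClassicalKernel (a b : ℝ) (k kx ky kxx kyy : ℝ → ℝ → ℝ) : Prop where
  cont : Continuous (Function.uncurry k)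
  cont_x : Continuous (Function.uncurry kx)
  cont_y : Continuous (Function.uncurry ky)
  cont_xx : Continuous (Function.uncurry kxx)
  cont_yy : Continuous (Function.uncurry kyy)
  deriv_x : ∀ x y, HasDerivAt (fun x => k x y) (kx x y) x
  deriv_y : ∀ x y, HasDerivAt (fun y => k x y) (ky x y) y
  deriv_xx : ∀ x y, HasDerivAt (fun x => kx x y) (kxx x y) x
  deriv_yy : ∀ x y, HasDerivAt (fun y => ky x y) (kyy x y) y
  diag : ∀ x, k x x = -(b / 2) * x
  deriv_diag : ∀ x, kx x x + ky x x = -(b / 2)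
  neumann : ∀ x, ky x 0 = 0
  equation : ∀ x y, kxx x y - kyy x y = a * k x y

namespace IsClassicalKernel

variable {a b : ℝ} {k kx ky kxx kyy : ℝ → ℝ → ℝ}

/-- The pieces agree at `y = x`, so each slice is a primitive of the glued derivative, with no point
mass there. -/
theorem hasWeakDeriv_glueL2 (h : IsClassicalKernel a b k kx ky kxx kyy) {L : ℝ} (hL : 0 ≤ L)
    {g : ℝ → ℝ} (hg : Continuous g) (hkg : ∀ x, k x x = g x) (x : ℝ) :
    HasWeakDeriv L (glueL2 h.cont hg L x)
      (glueL2 h.cont_y (continuous_const (y := (0 : ℝ))) L x) := by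
  have hk : ∀ u w, ∫ t in u..w, ky x t = k x w - k x u := fun u w =>
    intervalIntegral.integral_eq_sub_of_hasDerivAt (fun t _ => h.deriv_y x t)
      ((continuous_section h.cont_y x).intervalIntegrable _ _)
  refine hasWeakDeriv_toLp hL (glue_memLp h.cont hg L x) (glue_memLp h.cont_y continuous_const L x)
    -- The limit of the slice at `y = 0`: for `x ≤ 0` only the outer piece is seen on `(0, L)`.
    (c := if 0 < x then k x 0 else g x) fun y hy => ?_
  by_cases hx : 0 < x
  · rw [if_pos hx]
    by_cases hyx : y < x
    · rw [glue, if_pos hyx, intervalIntegral.integral_congr (g := fun t => ky x t), hk]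
      · ring
      · intro t ht
        rw [uIcc_of_le hy.1.le] at ht
        simp only [glue, if_pos (ht.2.trans_lt hyx)]
    · have := integral_glue_mul (v := fun _ => 1) h.cont_y (fun _ => 0)
        (s := x) (L := y) ⟨hx.le, not_lt.mp hyx⟩ intervalIntegrable_const
      simp only [mul_one, zero_mul, add_zero, hk] at this
      rw [this, glue, if_neg hyx, ← hkg]
      ring
  · have hyx : ∀ t, 0 ≤ t → ¬ t < x := fun t ht htx => hx (ht.trans_lt htx)
    rw [if_neg hx, glue, if_neg (hyx y hy.1.le), intervalIntegral.integral_congr (g := fun _ => 0)]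
    · simp
    · intro t ht
      rw [uIcc_of_le hy.1.le] at ht
      simp only [glue, if_neg (hyx t ht.1)]

theorem hasPartials (h : IsClassicalKernel a b k kx ky kxx kyy) :
    HasPartials b k (glue kx fun _ => -(b / 2)) (glue ky fun _ => 0) := by
  intro L hL
  have hg : Continuous fun x : ℝ => -(b / 2) * x := by fun_prop
  have hc : ∀ c : ℝ, Continuous fun _ : ℝ => c := fun c => continuous_const
  set P : ℝ → L2 L := glueL2 h.cont_x (hc (-(b / 2))) L with hP
  -- The second derivative has a regular part and a point mass at `y = s`. Its weight is the jump of
  -- `∂ₓ` across the diagonal, from `kx s s` inside to `-(b/2)` outside.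
  set R : ℝ → StrongDual ℝ (H1 L) := fun s =>
    toDual L (glueL2 h.cont_xx (hc 0) L s) + (kx s s + b / 2) • evAt L s with hR
  have hRc : Continuous R :=
    (((innerSL ℝ).continuous.comp (continuous_glueL2 _ _ L)).clm_comp continuous_const).add
      (((continuous_diag h.cont_x).add continuous_const).smul (continuous_evAt L))
  -- The integrated form can be checked on one `v` at a time; continuity of `R` in the dual norm
  -- then gives differentiability in that norm.
  have hPR : ∀ s ∈ Icc 0 L, toDual L (P s) = toDual L (P 0) + ∫ r in 0..s, R r := by
    intro s hs
    refine eq_add_integral_of_apply (F := fun s => toDual L (P s)) hRc fun v => ?_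
    obtain ⟨V, hVc, hV, hvV⟩ := H1.exists_continuous_rep hL v
    have hkV : Continuous (Function.uncurry fun x y => kx x y * V y) :=
      h.cont_x.mul (hVc.comp continuous_snd)
    have hkV' : Continuous (Function.uncurry fun x y => kxx x y * V y) :=
      h.cont_xx.mul (hVc.comp continuous_snd)
    have hglue : ∀ (p : ℝ → ℝ → ℝ) (c : ℝ) (hp : Continuous (Function.uncurry p)), ∀ r ∈ Icc 0 L,
        toDual L (glueL2 hp (hc c) L r) v
          = (∫ y in 0..r, p r y * V y) + c * ((∫ y in 0..L, V y) - ∫ y in 0..r, V y) := by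
      intro p c hp r hr
      rw [toDual, ContinuousLinearMap.comp_apply, innerSL_apply_apply, inner_glueL2,
        ← integral_zero_eq_Ioo hL.le, integral_toL2_eq hvV _ (right_mem_Icc.mpr hL.le),
        integral_glue_mul hp _ hr (hVc.intervalIntegrable _ _),
        intervalIntegral.integral_interval_sub_left (hVc.intervalIntegrable _ _)
          (hVc.intervalIntegrable _ _)]
    rw [hglue _ _ _ s hs, hglue _ _ _ 0 (left_mem_Icc.mpr hL.le)]
    have hd : ∀ r ∈ uIcc 0 s, HasDerivAt (fun r => (∫ y in 0..r, kx r y * V y)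
        + -(b / 2) * ((∫ y in 0..L, V y) - ∫ y in 0..r, V y)) (R r v) r := by
      intro r hr
      rw [uIcc_of_le hs.1] at hr
      have hr' : r ∈ Icc 0 L := ⟨hr.1, hr.2.trans hs.2⟩
      refine ((hasDerivAt_integral_diag hkV hkV' (fun x y => (h.deriv_xx x y).mul_const (V y))
        r).add (((hasDerivAt_primitive hVc r).const_sub _).const_mul _)).congr_deriv ?_
      simp only [hR, _root_.add_apply, _root_.smul_apply]
      rw [hglue _ _ _ r hr', evAt_apply hL hV hvV hr', smul_eq_mul]
      ring
    rw [intervalIntegral.integral_eq_sub_of_hasDerivAt hd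
      ((hRc.clm_apply continuous_const).intervalIntegrable _ _)]
    ring
  refine ⟨fun s => H1.mk (h.hasWeakDeriv_glueL2 hL.le hg h.diag s), P, R, ?_,
    (continuous_glueL2 _ _ L).continuousOn, hRc.continuousOn, ?_, ?_, ?_⟩
  · refine Continuous.continuousOn (Continuous.subtype_mk ?_ _)
    exact (WithLp.prod_continuous_toLp 2 _ _).comp
      ((continuous_glueL2 _ _ L).prodMk (continuous_glueL2 _ _ L))
  · intro x _
    refine ⟨?_, coeFn_glueL2 h.cont_y (hc 0) L x, coeFn_glueL2 h.cont_x (hc _) L x⟩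
    filter_upwards [coeFn_glueL2 h.cont hg L x, ae_restrict_mem measurableSet_Ioo] with y hy hyL
    rw [H1.toL2_mk, hy, extendKernel, glue]
    rcases lt_trichotomy y x with hxy | hxy | hxy
    · rw [if_pos hxy, if_pos ⟨hyL.1, hxy.le⟩]
    · rw [if_neg hxy.not_lt, if_pos ⟨hyL.1, hxy.le⟩, hxy, h.diag]
    · rw [if_neg hxy.not_gt, if_neg fun hh => hxy.not_ge hh.2]
  · intro x _
    refine (hasDerivAt_glueL2 h.diag h.cont hg h.cont_x (hc _) h.deriv_x (fun x => ?_) L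
      x).hasDerivWithinAt
    exact ((hasDerivAt_id' x).const_mul (-(b / 2))).congr_deriv (mul_one _)
  · intro x hx
    refine (((hasDerivAt_primitive hRc x).const_add (toDual L (P 0))).hasDerivWithinAt).congr_of_mem
      hPR hx

/-- Integrate by parts in `x` against `w'` and in `y` against `v'`. The terms at `x = L` cancel, the
Neumann condition removes the term at `y = 0`, and the two diagonal terms combine through `kx + ky =
-(b/2)`. -/
theorem weakIdentity (h : IsClassicalKernel a b k kx ky kxx kyy) :
    WeakIdentity a b k (glue kx fun _ => -(b / 2)) (glue ky fun _ => 0) := by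
  rintro L hL v w wL ⟨r, hr, hwr, rfl⟩
  obtain ⟨V, hVc, hV, hvV⟩ := H1.exists_continuous_rep hL v
  obtain ⟨W, hWc, hW, hwW⟩ := H1.exists_continuous_rep hL w
  have hL' : L ∈ Icc 0 L := right_mem_Icc.mpr hL.le
  -- The end value does not depend on the representative: two functions continuous on `[0, L]` that
  -- agree almost everywhere agree at `L`.
  have hrW : r L = W L := by
    refine Measure.eqOn_Icc_of_ae_eq (μ := volume) hL.ne ?_ hr hWc.continuousOn hL'
    rw [Measure.restrict_congr_set Ioo_ae_eq_Icc.symm]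
    exact hwr.symm.trans hwW
  have hglue : ∀ (p : ℝ → ℝ → ℝ) (q : ℝ → ℝ) (x : ℝ), 0 ≤ x → ∀ u : ℝ → ℝ,
      ∫ y in 0..x, glue p q x y * u y = ∫ y in 0..x, p x y * u y := by
    intro p q x hx u
    rw [integral_zero_eq_Ioo hx, integral_zero_eq_Ioo hx]
    refine setIntegral_congr_fun measurableSet_Ioo fun y hy => ?_
    simp only [glue, if_pos hy.2]
  have hpV : ∀ {p : ℝ → ℝ → ℝ}, Continuous (Function.uncurry p) →
      Continuous (Function.uncurry fun x y => p x y * V y) := fun hp =>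
    hp.mul (hVc.comp continuous_snd)
  set A : ℝ → ℝ := fun x => ∫ y in 0..x, kx x y * V y
  set A' : ℝ → ℝ := fun x => kx x x * V x + ∫ y in 0..x, kxx x y * V y
  have hA : ∀ x, HasDerivAt A (A' x) x :=
    hasDerivAt_integral_diag (hpV h.cont_x) (hpV h.cont_xx)
      fun x y => (h.deriv_xx x y).mul_const (V y)
  have hA' : Continuous A' :=
    ((continuous_diag h.cont_x).mul hVc).add (continuous_integral_diag (hpV h.cont_xx))
  have hx0 : ∀ x ∈ uIcc 0 L, x ∈ Icc 0 L := fun x hx => by rwa [uIcc_of_le hL.le] at hx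
  have e1 : ∫ x in 0..L, (∫ y in 0..x, glue kx (fun _ => -(b / 2)) x y * H1.toL2 L v y)
      * H1.weakDeriv L w x = A L * W L - ∫ x in 0..L, A' x * W x := by
    have : ∀ x ∈ uIcc 0 L, (∫ y in 0..x, glue kx (fun _ => -(b / 2)) x y * H1.toL2 L v y)
        * H1.weakDeriv L w x = A x * H1.weakDeriv L w x := fun x hx => by
      rw [hglue _ _ x (hx0 x hx).1, integral_toL2_eq hvV _ (hx0 x hx)]
    rw [intervalIntegral.integral_congr this, integral_mul_eq_sub_integral_deriv_mul hA hA'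
      (L2.intervalIntegrable _ hL') (W 0), ← hW L hL']
    have h0 : A 0 = 0 := intervalIntegral.integral_same
    rw [h0, zero_mul, sub_zero]
    congr 1
    refine intervalIntegral.integral_congr fun x hx => ?_
    rw [← hW x (hx0 x hx)]
  have e2 : ∫ y in 0..L, glue kx (fun _ => -(b / 2)) L y * H1.toL2 L v y = A L := by
    rw [hglue _ _ L hL.le, integral_toL2_eq hvV _ hL']
  have e3 : ∫ x in 0..L, (∫ y in 0..x, glue ky (fun _ => 0) x y * H1.weakDeriv L v y)
      * H1.toL2 L w x
      = ∫ x in 0..L, (ky x x * V x - ∫ y in 0..x, kyy x y * V y) * W x := by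
    rw [integral_toL2_eq hwW _ hL']
    refine intervalIntegral.integral_congr fun x hx => ?_
    have hx' := hx0 x hx
    rw [hglue _ _ x hx'.1, integral_mul_eq_sub_integral_deriv_mul (h.deriv_yy x)
      (continuous_section h.cont_yy x) (L2.intervalIntegrable _ hx') (V 0), ← hV x hx',
      h.neumann, zero_mul, sub_zero]
    congr 2
    refine intervalIntegral.integral_congr fun y hy => ?_
    rw [uIcc_of_le hx'.1] at hy
    rw [← hV y ⟨hy.1, hy.2.trans hx'.2⟩]
  have e4 : ∫ x in 0..L, (∫ y in 0..x, k x y * H1.toL2 L v y) * H1.toL2 L w x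
      = ∫ x in 0..L, (∫ y in 0..x, k x y * V y) * W x := by
    rw [integral_toL2_eq hwW _ hL']
    refine intervalIntegral.integral_congr fun x hx => ?_
    rw [integral_toL2_eq hvV _ (hx0 x hx)]
  have e5 : ∫ x in 0..L, H1.toL2 L v x * H1.toL2 L w x = ∫ x in 0..L, V x * W x := by
    rw [integral_toL2_eq hwW _ hL']
    simp only [mul_comm _ (W _)]
    rw [integral_toL2_eq hvV _ hL']
  have c1 : Continuous fun x => A' x * W x := hA'.mul hWc
  have c2 : Continuous fun x => (ky x x * V x - ∫ y in 0..x, kyy x y * V y) * W x :=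
    (((continuous_diag h.cont_y).mul hVc).sub (continuous_integral_diag (hpV h.cont_yy))).mul hWc
  have c3 : Continuous fun x => (∫ y in 0..x, k x y * V y) * W x :=
    (continuous_integral_diag (hpV h.cont)).mul hWc
  have c4 : Continuous fun x => V x * W x := hVc.mul hWc
  have key : (∫ x in 0..L, A' x * W x)
      + (∫ x in 0..L, (ky x x * V x - ∫ y in 0..x, kyy x y * V y) * W x)
      = a * (∫ x in 0..L, (∫ y in 0..x, k x y * V y) * W x) - b / 2 * ∫ x in 0..L, V x * W x := by
    rw [← intervalIntegral.integral_add (c1.intervalIntegrable _ _) (c2.intervalIntegrable _ _),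
      ← intervalIntegral.integral_const_mul, ← intervalIntegral.integral_const_mul,
      ← intervalIntegral.integral_sub ((c3.const_mul a).intervalIntegrable _ _)
        ((c4.const_mul (b / 2)).intervalIntegrable _ _)]
    refine intervalIntegral.integral_congr fun x _ => ?_
    have e : (∫ y in 0..x, kxx x y * V y) - (∫ y in 0..x, kyy x y * V y)
        = a * ∫ y in 0..x, k x y * V y := by
      rw [← intervalIntegral.integral_const_mul, ← intervalIntegral.integral_sub
        ((continuous_section (hpV h.cont_xx) x).intervalIntegrable _ _)
        ((continuous_section (hpV h.cont_yy) x).intervalIntegrable _ _)]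
      refine intervalIntegral.integral_congr fun y _ => ?_
      rw [← sub_mul, h.equation, mul_assoc]
    have e' := h.deriv_diag x
    simp only [A']
    linear_combination W x * e + V x * W x * e'
  rw [e1, e2, e3, e4, e5, hrW]
  linarith

theorem isWeakSolution (h : IsClassicalKernel a b k kx ky kxx kyy) : IsWeakSolution a b k :=
  ⟨_, _, h.hasPartials, h.weakIdentity⟩

end IsClassicalKernel

/-! ### The explicit kernel -/

/-- The solution `-(b/2) x ∑ (a(x² - y²)/4)ⁿ / (n! (n + 1)!)` of the kernel problem. -/
def besselKernel (a b x y : ℝ) : ℝ := -(b / 2) * (x * bes 1 (a / 4 * (x ^ 2 - y ^ 2)))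

/-- The `x`-derivative of `besselKernel`. -/
def besselKernelX (a b x y : ℝ) : ℝ :=
  -(b / 2) * (bes 1 (a / 4 * (x ^ 2 - y ^ 2)) + a / 2 * x ^ 2 * bes 2 (a / 4 * (x ^ 2 - y ^ 2)))

/-- The `y`-derivative of `besselKernel`. -/
def besselKernelY (a b x y : ℝ) : ℝ :=
  b / 2 * (a / 2 * x * y * bes 2 (a / 4 * (x ^ 2 - y ^ 2)))

theorem hasDerivAt_bes_x (m : ℕ) (a x y : ℝ) :
    HasDerivAt (fun x => bes m (a / 4 * (x ^ 2 - y ^ 2)))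
      (bes (m + 1) (a / 4 * (x ^ 2 - y ^ 2)) * (a / 2 * x)) x := by
  have h : HasDerivAt (fun x : ℝ => a / 4 * (x ^ 2 - y ^ 2)) (a / 2 * x) x :=
    (((hasDerivAt_pow 2 x).sub_const (y ^ 2)).const_mul (a / 4)).congr_deriv (by simp; ring)
  exact (bes_hasDerivAt m _).comp x h

theorem hasDerivAt_bes_y (m : ℕ) (a x y : ℝ) :
    HasDerivAt (fun y => bes m (a / 4 * (x ^ 2 - y ^ 2)))
      (bes (m + 1) (a / 4 * (x ^ 2 - y ^ 2)) * (-(a / 2 * y))) y := by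
  have h : HasDerivAt (fun y : ℝ => a / 4 * (x ^ 2 - y ^ 2)) (-(a / 2 * y)) y :=
    (((hasDerivAt_pow 2 y).const_sub (x ^ 2)).const_mul (a / 4)).congr_deriv (by simp; ring)
  exact (bes_hasDerivAt m _).comp y h

theorem continuous_bes_uncurry (m : ℕ) (a : ℝ) :
    Continuous fun p : ℝ × ℝ => bes m (a / 4 * (p.1 ^ 2 - p.2 ^ 2)) :=
  (bes_continuous m).comp (by fun_prop)

theorem isClassicalKernel_besselKernel (a b : ℝ) :
    IsClassicalKernel a b (besselKernel a b) (besselKernelX a b) (besselKernelY a b)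
      (fun x y => -(b / 2) * (3 / 2 * a * x * bes 2 (a / 4 * (x ^ 2 - y ^ 2))
        + a ^ 2 / 4 * x ^ 3 * bes 3 (a / 4 * (x ^ 2 - y ^ 2))))
      (fun x y => b / 2 * (a / 2 * x * bes 2 (a / 4 * (x ^ 2 - y ^ 2))
        - a ^ 2 / 4 * x * y ^ 2 * bes 3 (a / 4 * (x ^ 2 - y ^ 2)))) := by
  have c1 := continuous_bes_uncurry 1 a
  have c2 := continuous_bes_uncurry 2 a
  have c3 := continuous_bes_uncurry 3 a
  have b0 : ∀ m x, bes m (a / 4 * (x ^ 2 - x ^ 2)) = 1 / (m.factorial : ℝ) := fun m x => by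
    rw [sub_self, mul_zero, bes_zero]
  constructor
  · simp only [Function.uncurry_def, besselKernel]; fun_prop
  · simp only [Function.uncurry_def, besselKernelX]; fun_prop
  · simp only [Function.uncurry_def, besselKernelY]; fun_prop
  · simp only [Function.uncurry_def]; fun_prop
  · simp only [Function.uncurry_def]; fun_prop
  · intro x y
    refine (((hasDerivAt_id' x).mul (hasDerivAt_bes_x 1 a x y)).const_mul
      (-(b / 2))).congr_deriv ?_
    rw [besselKernelX]; ring
  · intro x y
    refine (((hasDerivAt_bes_y 1 a x y).const_mul x).const_mul (-(b / 2))).congr_deriv ?_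
    rw [besselKernelY]; ring
  · intro x y
    refine (((hasDerivAt_bes_x 1 a x y).add (((hasDerivAt_pow 2 x).const_mul (a / 2)).mul
      (hasDerivAt_bes_x 2 a x y))).const_mul (-(b / 2))).congr_deriv ?_
    norm_num [-mul_eq_mul_left_iff, -mul_eq_mul_right_iff, -neg_mul, -neg_inj]
    ring
  · intro x y
    refine ((((hasDerivAt_id' y).const_mul (a / 2 * x)).mul
      (hasDerivAt_bes_y 2 a x y)).const_mul (b / 2)).congr_deriv ?_
    norm_num [-mul_eq_mul_left_iff, -mul_eq_mul_right_iff, -neg_mul, -neg_inj]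
    ring
  · intro x
    rw [besselKernel, b0]; simp
  · intro x
    rw [besselKernelX, besselKernelY, b0, b0]; simp; ring
  · intro x
    simp [besselKernelY]
  · intro x y
    have h := bes_recurrence 1 (a / 4 * (x ^ 2 - y ^ 2))
    norm_num at h
    simp only [besselKernel]
    rw [← h]
    ring

/-! ### Two vanishing principles -/

/-- This is `D'' = a D` with zero initial data. Grönwall's inequality applies to the pair `(D, D')`
in the sup norm, with constant `max 1 |a|`. -/
theorem eq_zero_of_hasDerivWithinAt_integral {a L : ℝ} (hL : 0 < L) {D : ℝ → ℝ}
    (hD : ContinuousOn D (Icc 0 L)) (h0 : D 0 = 0)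
    (hd : ∀ x ∈ Ioc 0 L, HasDerivWithinAt D (a * ∫ t in 0..x, D t) (Icc 0 L) x) :
    ∀ x ∈ Icc 0 L, D x = 0 := by
  set G : ℝ → ℝ := fun x => D (max 0 (min x L))
  have hG : Continuous G := hD.comp_continuous (by fun_prop)
    fun y => ⟨le_max_left _ _, max_le hL.le (min_le_right _ _)⟩
  have hGD : ∀ x ∈ Icc 0 L, G x = D x := fun x hx => by
    simp only [G]
    rw [min_eq_left hx.2, max_eq_right hx.1]
  set p : ℝ → ℝ := fun x => a * ∫ t in 0..x, G t
  have hp : ∀ x, HasDerivAt p (a * G x) x := fun x => (hasDerivAt_primitive hG x).const_mul a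
  have hpc : Continuous p := continuous_iff_continuousAt.mpr fun x => (hp x).continuousAt
  have hpD : ∀ x ∈ Icc 0 L, p x = a * ∫ t in 0..x, D t := fun x hx => by
    simp only [p]
    congr 1
    refine intervalIntegral.integral_congr fun t ht => ?_
    rw [uIcc_of_le hx.1] at ht
    exact hGD t ⟨ht.1, ht.2.trans hx.2⟩
  have hE : ∀ x ∈ Icc 0 L, D x = ∫ t in 0..x, p t := by
    intro x hx
    rw [intervalIntegral.integral_eq_sub_of_hasDerivAt_of_le hx.1
      (hD.mono (Icc_subset_Icc_right hx.2)) (fun t ht => ?_) (hpc.intervalIntegrable _ _), h0,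
      sub_zero]
    have htL : t ∈ Ioo 0 L := ⟨ht.1, ht.2.trans_le hx.2⟩
    rw [hpD t (Ioo_subset_Icc_self htL)]
    exact (hd t (Ioo_subset_Ioc_self htL)).hasDerivAt (Icc_mem_nhds htL.1 htL.2)
  have hF : ∀ x, HasDerivAt (fun x => ((∫ t in 0..x, p t), p x)) (p x, a * G x) x := fun x =>
    (hasDerivAt_primitive hpc x).prodMk (hp x)
  have hz := eq_zero_of_abs_deriv_le_mul_abs_self_of_eq_zero_right (K := max 1 |a|)
    (f := fun x => ((∫ t in 0..x, p t), p x)) (a := 0) (b := L)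
    (fun x _ => (hF x).continuousAt.continuousWithinAt) (fun x _ => (hF x).hasDerivWithinAt)
    (by simp [p]) fun x hx => by
      have hx' := Ico_subset_Icc_self hx
      rw [hGD x hx', hE x hx', Prod.norm_def, Prod.norm_def]
      simp only [norm_mul, Real.norm_eq_abs]
      refine max_le ?_ ?_
      · refine (le_max_right |∫ t in 0..x, p t| |p x|).trans (le_mul_of_one_le_left ?_
          (le_max_left _ _))
        exact (abs_nonneg _).trans (le_max_left _ _)
      · gcongr
        · exact le_max_right _ _
        · exact le_max_left _ _
  intro x hx
  rw [hE x hx]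
  exact congrArg Prod.fst (hz x hx)

/-- The substitution `s = y²` is a homeomorphism on `[0, x]`. Weierstrass approximation of `φ(√s)`
on `[0, x²]` thus approximates `φ` uniformly by polynomials in `y²`. -/
theorem ae_eq_zero_of_even_moments {x : ℝ} {f : ℝ → ℝ} (hf : IntegrableOn f (Ioo 0 x))
    (h : ∀ n : ℕ, ∫ y in Ioo 0 x, f y * y ^ (2 * n) = 0) :
    ∀ᵐ y ∂(volume.restrict (Ioo 0 x)), f y = 0 := by
  refine ae_eq_zero_of_forall_test hf fun φ hφ => ?_
  have hi : ∀ g : ℝ → ℝ, Continuous g → IntegrableOn (fun y => f y * g y) (Ioo 0 x) := by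
    intro g hg
    obtain ⟨C, hC⟩ := isCompact_Icc.exists_bound_of_continuousOn (s := Icc 0 x) hg.continuousOn
    refine hf.mul_bdd (c := C) hg.aestronglyMeasurable ?_
    filter_upwards [ae_restrict_mem measurableSet_Ioo] with y hy
    exact hC y (Ioo_subset_Icc_self hy)
  have hpoly : ∀ p : Polynomial ℝ, ∫ y in Ioo 0 x, f y * p.eval (y ^ 2) = 0 := by
    intro p
    simp only [Polynomial.eval_eq_sum_range, Finset.mul_sum]
    rw [integral_finsetSum _ fun i _ => hi _ (by fun_prop)]
    refine Finset.sum_eq_zero fun i _ => ?_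
    have e : ∀ y : ℝ, f y * (p.coeff i * (y ^ 2) ^ i) = p.coeff i * (f y * y ^ (2 * i)) := by
      intro y
      rw [pow_mul]; ring
    simp only [e]
    rw [integral_const_mul, h, mul_zero]
  set I := ∫ y in Ioo 0 x, |f y|
  have hI : 0 ≤ I := integral_nonneg fun y => abs_nonneg _
  have hsmall : ∀ ε : ℝ, 0 < ε → |∫ y in Ioo 0 x, f y * φ y| ≤ I * ε := by
    intro ε hε
    obtain ⟨p, hp⟩ := exists_polynomial_near_of_continuousOn 0 (x ^ 2) (fun s => φ √s)
      (hφ.smooth.continuous.comp Real.continuous_sqrt).continuousOn ε hε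
    have e : ∫ y in Ioo 0 x, f y * φ y = ∫ y in Ioo 0 x, f y * (φ y - p.eval (y ^ 2)) := by
      simp only [mul_sub]
      rw [integral_sub (hi _ hφ.smooth.continuous) (hi _ (by fun_prop)), hpoly, sub_zero]
    rw [e, ← Real.norm_eq_abs]
    simp only [I]
    rw [← integral_mul_const]
    refine norm_integral_le_of_norm_le (hf.abs.mul_const ε) ?_
    filter_upwards [ae_restrict_mem measurableSet_Ioo] with y hy
    rw [norm_mul, Real.norm_eq_abs, Real.norm_eq_abs]
    have := hp (y ^ 2) ⟨by positivity, by have := hy.1; have := hy.2; gcongr⟩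
    simp only [Real.sqrt_sq hy.1.le] at this
    rw [abs_sub_comm] at this
    gcongr
  by_contra hne
  have hpos := abs_pos.mpr hne
  -- With this `ε` the bound `I ε` is strictly below the integral; the `+ 1` covers `I = 0`.
  have h1 := hsmall (|∫ y in Ioo 0 x, f y * φ y| / (2 * (I + 1))) (by positivity)
  have h2 : I * (|∫ y in Ioo 0 x, f y * φ y| / (2 * (I + 1)))
      = |∫ y in Ioo 0 x, f y * φ y| * (I / (2 * (I + 1))) := by ring
  have h3 : I / (2 * (I + 1)) < 1 := by rw [div_lt_one (by positivity)]; linarith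
  rw [h2] at h1
  nlinarith

/-! ### Moments of a weak solution -/

/-- The integral of the slice `k(x, ·)` over `(0, x)` against `v`. -/
def moment (k : ℝ → ℝ → ℝ) (v : ℝ → ℝ) (x : ℝ) : ℝ := ∫ y in 0..x, k x y * v y

theorem extendKernel_of_lt {b : ℝ} {k : ℝ → ℝ → ℝ} {x y : ℝ} (h : x < y) :
    extendKernel b k x y = -(b / 2) * x := by
  rw [extendKernel, if_neg fun hh => h.not_ge hh.2]

theorem extendKernel_of_le {b : ℝ} {k : ℝ → ℝ → ℝ} {x y : ℝ} (h0 : 0 < y) (h : y ≤ x) :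
    extendKernel b k x y = k x y := by
  rw [extendKernel, if_pos ⟨h0, h⟩]

theorem L2.mul_intervalIntegrable {L : ℝ} (u : L2 L) {v : ℝ → ℝ} (hv : Continuous v) {s t : ℝ}
    (hs : s ∈ Icc 0 L) (ht : t ∈ Icc 0 L) :
    IntervalIntegrable (fun y => u y * v y) volume s t := by
  have hL : 0 ≤ L := hs.1.trans hs.2
  refine ((L2.intervalIntegrable u (right_mem_Icc.mpr hL)).mul_continuousOn
    hv.continuousOn).mono_set ?_
  rw [uIcc_of_le hL]
  exact uIcc_subset_Icc hs ht

theorem integral_congr_Ioo {L s t : ℝ} {u v : ℝ → ℝ} (hst : s ≤ t) (hs : 0 ≤ s) (ht : t ≤ L)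
    (h : ∀ᵐ y ∂(volume.restrict (Ioo 0 L)), y ∈ Ioo s t → u y = v y) :
    ∫ y in s..t, u y = ∫ y in s..t, v y := by
  rw [intervalIntegral.integral_of_le hst, intervalIntegral.integral_of_le hst,
    integral_Ioc_eq_integral_Ioo, integral_Ioc_eq_integral_Ioo]
  refine integral_congr_ae ?_
  filter_upwards [ae_restrict_of_ae_restrict_of_subset (Ioo_subset_Ioo hs ht) h,
    ae_restrict_mem measurableSet_Ioo] with y hy hys
  exact hy hys

section Regular

variable {b L : ℝ} {k kx ky : ℝ → ℝ → ℝ} {U P : ℝ → L2 L}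

theorem integral_outer (hU : ∀ x ∈ Icc 0 L,
      (U x : ℝ → ℝ) =ᵐ[volume.restrict (Ioo 0 L)] extendKernel b k x)
    (v : ℝ → ℝ) {s x : ℝ} (hs : 0 ≤ s) (hsx : s ≤ x) (hx : x ≤ L) :
    ∫ y in x..L, U s y * v y = -(b / 2) * s * ∫ y in x..L, v y := by
  rw [← intervalIntegral.integral_const_mul]
  refine integral_congr_Ioo hx (hs.trans hsx) le_rfl ?_
  filter_upwards [hU s ⟨hs, hsx.trans hx⟩] with y hy hyx
  rw [hy, extendKernel_of_lt (hsx.trans_lt hyx.1)]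

theorem integral_inner_part (hU : ∀ x ∈ Icc 0 L,
      (U x : ℝ → ℝ) =ᵐ[volume.restrict (Ioo 0 L)] extendKernel b k x)
    (v : ℝ → ℝ) {x : ℝ} (hx : x ∈ Icc 0 L) :
    ∫ y in 0..x, U x y * v y = moment k v x := by
  refine integral_congr_Ioo hx.1 le_rfl hx.2 ?_
  filter_upwards [hU x hx] with y hy hyx
  rw [hy, extendKernel_of_le hyx.1 hyx.2.le]

theorem hasDerivWithinAt_integral_mul
    (hUP : ∀ x ∈ Icc 0 L, HasDerivWithinAt U (P x) (Icc 0 L) x) {v : ℝ → ℝ}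
    (hv : MemLp v 2 (volume.restrict (Ioo 0 L))) {x : ℝ} (hx : x ∈ Icc 0 L) :
    HasDerivWithinAt (fun s => ∫ y in 0..L, U s y * v y) (∫ y in 0..L, P x y * v y)
      (Icc 0 L) x := by
  have h := (innerSL ℝ (hv.toLp v)).hasFDerivAt.comp_hasDerivWithinAt x (hUP x hx)
  have e : ∀ u : L2 L, innerSL ℝ (hv.toLp v) u = ∫ y in 0..L, u y * v y := fun u => by
    rw [innerSL_apply_apply, inner_toLp_left, integral_zero_eq_Ioo (hx.1.trans hx.2)]
    simp only [mul_comm]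
  simpa only [Function.comp_def, e] using h

/-- For `s ≤ x` the slice at `s` equals `-(b/2) s` on all of `(x, L)`. Pairing with the indicator of
`(x, ∞)` and taking the left derivative at `x`, available since `x > 0`, gives the value. -/
theorem integral_deriv_outer (hU : ∀ x ∈ Icc 0 L,
      (U x : ℝ → ℝ) =ᵐ[volume.restrict (Ioo 0 L)] extendKernel b k x)
    (hUP : ∀ x ∈ Icc 0 L, HasDerivWithinAt U (P x) (Icc 0 L) x) {v : ℝ → ℝ} (hv : Continuous v)
    {x : ℝ} (hx : x ∈ Ioc 0 L) :
    ∫ y in x..L, P x y * v y = -(b / 2) * ∫ y in x..L, v y := by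
  have hx' := Ioc_subset_Icc_self hx
  have hL : 0 ≤ L := hx'.1.trans hx'.2
  have hw : MemLp ((Ioi x).indicator v) 2 (volume.restrict (Ioo 0 L)) :=
    (memLp_of_continuous hv L).indicator measurableSet_Ioi
  have e : ∀ u : L2 L, ∫ y in 0..L, u y * (Ioi x).indicator v y = ∫ y in x..L, u y * v y := by
    intro u
    have e1 : ∀ y, u y * (Ioi x).indicator v y = (Ioi x).indicator (fun y => u y * v y) y :=
      fun y => by
        by_cases hy : y ∈ Ioi x
        · rw [indicator_of_mem hy, indicator_of_mem hy]
        · rw [indicator_of_notMem hy, indicator_of_notMem hy, mul_zero]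
    simp only [e1]
    rw [intervalIntegral.integral_of_le hL, intervalIntegral.integral_of_le hx.2,
      setIntegral_indicator measurableSet_Ioi]
    congr 2
    ext y
    simp only [mem_inter_iff, mem_Ioc, mem_Ioi]
    exact ⟨fun h => ⟨h.2, h.1.2⟩, fun h => ⟨⟨hx.1.trans h.1, h.2⟩, h.1⟩⟩
  have h1 := (hasDerivWithinAt_integral_mul hUP hw hx').mono (Icc_subset_Icc_right hx.2)
  simp only [e] at h1
  have h2 : HasDerivWithinAt (fun s => -(b / 2) * s * ∫ y in x..L, v y)
      (-(b / 2) * ∫ y in x..L, v y) (Icc 0 x) x :=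
    ((((hasDerivAt_id' x).const_mul (-(b / 2))).mul_const _).congr_deriv
      (by rw [mul_one])).hasDerivWithinAt
  have h3 := h2.congr_of_mem (f₁ := fun s => ∫ y in x..L, U s y * v y)
    (fun s hs => integral_outer hU v hs.1 hs.2 hx.2) (right_mem_Icc.mpr hx.1.le)
  exact (uniqueDiffOn_Icc hx.1 x (right_mem_Icc.mpr hx.1.le)).eq_deriv _ h1 h3

/-- Trades the moving upper limit for a pairing on the fixed interval `(0, L)`, where the `L²`
regularity in `x` can be used. -/
theorem moment_eq (hU : ∀ x ∈ Icc 0 L,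
      (U x : ℝ → ℝ) =ᵐ[volume.restrict (Ioo 0 L)] extendKernel b k x)
    {v : ℝ → ℝ} (hv : Continuous v) {x : ℝ} (hx : x ∈ Icc 0 L) :
    moment k v x = (∫ y in 0..L, U x y * v y)
      + b / 2 * (x * ((∫ y in 0..L, v y) - ∫ y in 0..x, v y)) := by
  have hL : 0 ≤ L := hx.1.trans hx.2
  have h0 : (0 : ℝ) ∈ Icc 0 L := left_mem_Icc.mpr hL
  have h1 : L ∈ Icc 0 L := right_mem_Icc.mpr hL
  rw [← integral_inner_part hU v hx, ← intervalIntegral.integral_add_adjacent_intervals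
    (L2.mul_intervalIntegrable (U x) hv h0 hx) (L2.mul_intervalIntegrable (U x) hv hx h1),
    integral_outer hU v hx.1 le_rfl hx.2, intervalIntegral.integral_interval_sub_left
      (hv.intervalIntegrable _ _) (hv.intervalIntegrable _ _)]
  ring

theorem continuousOn_moment (hUc : ContinuousOn U (Icc 0 L)) (hU : ∀ x ∈ Icc 0 L,
      (U x : ℝ → ℝ) =ᵐ[volume.restrict (Ioo 0 L)] extendKernel b k x)
    {v : ℝ → ℝ} (hv : Continuous v) : ContinuousOn (moment k v) (Icc 0 L) := by
  refine ContinuousOn.congr ?_ fun x hx => moment_eq hU hv hx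
  refine ContinuousOn.add ?_ (Continuous.continuousOn ?_)
  · have h := (innerSL ℝ ((memLp_of_continuous hv L).toLp v)).continuous.comp_continuousOn hUc
    refine h.congr fun x hx => ?_
    simp only [Function.comp_def]
    rw [innerSL_apply_apply, inner_toLp_left, integral_zero_eq_Ioo (hx.1.trans hx.2)]
    simp only [mul_comm]
  · exact continuous_const.mul (continuous_id.mul (continuous_const.sub
      (intervalIntegral.continuous_primitive (fun _ _ => hv.intervalIntegrable _ _) 0)))

/-- Leibniz's rule with boundary term `k(x,x) v(x)`; the diagonal value enters through the exterior
part and not through a trace of `k`. -/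
theorem hasDerivWithinAt_moment (hU : ∀ x ∈ Icc 0 L,
      (U x : ℝ → ℝ) =ᵐ[volume.restrict (Ioo 0 L)] extendKernel b k x)
    (hPx : ∀ x ∈ Icc 0 L, (P x : ℝ → ℝ) =ᵐ[volume.restrict (Ioo 0 L)] kx x)
    (hUP : ∀ x ∈ Icc 0 L, HasDerivWithinAt U (P x) (Icc 0 L) x) {v : ℝ → ℝ} (hv : Continuous v)
    {x : ℝ} (hx : x ∈ Ioc 0 L) :
    HasDerivWithinAt (moment k v) (moment kx v x - b / 2 * (x * v x)) (Icc 0 L) x := by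
  have hx' := Ioc_subset_Icc_self hx
  have hL : 0 ≤ L := hx'.1.trans hx'.2
  have h0 : (0 : ℝ) ∈ Icc 0 L := left_mem_Icc.mpr hL
  have hL' : L ∈ Icc 0 L := right_mem_Icc.mpr hL
  have h1 := hasDerivWithinAt_integral_mul hUP (memLp_of_continuous hv L) hx'
  have h2 : HasDerivAt (fun x => b / 2 * (x * ((∫ y in 0..L, v y) - ∫ y in 0..x, v y)))
      (b / 2 * (1 * ((∫ y in 0..L, v y) - ∫ y in 0..x, v y) + x * (-v x))) x :=
    ((hasDerivAt_id' x).mul ((hasDerivAt_primitive hv x).const_sub _)).const_mul _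
  refine ((h1.add h2.hasDerivWithinAt).congr_of_mem (fun s hs => moment_eq hU hv hs)
    hx').congr_deriv ?_
  have e1 : ∫ y in 0..x, P x y * v y = moment kx v x := by
    refine integral_congr_Ioo hx'.1 le_rfl hx'.2 ?_
    filter_upwards [hPx x hx'] with y hy _
    rw [hy]
  rw [← intervalIntegral.integral_add_adjacent_intervals
    (L2.mul_intervalIntegrable (P x) hv h0 hx') (L2.mul_intervalIntegrable (P x) hv hx' hL'),
    e1, integral_deriv_outer hU hUP hv hx, ← intervalIntegral.integral_interval_sub_left
      (hv.intervalIntegrable 0 L) (hv.intervalIntegrable 0 x)]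
  ring

/-- The continuous representative of the slice equals `-(b/2) x` on `(x, L)`, hence also at `y = x`;
this needs `x < L`. Integration by parts on `(0, x)` then has a known term at `x` and none at `0`,
as `v 0 = 0`. -/
theorem moment_weakDeriv {Y : L2 L} (hU : ∀ x ∈ Icc 0 L,
      (U x : ℝ → ℝ) =ᵐ[volume.restrict (Ioo 0 L)] extendKernel b k x)
    {x : ℝ} (hx : x ∈ Ioo 0 L) (hUY : HasWeakDeriv L (U x) Y)
    (hY : (Y : ℝ → ℝ) =ᵐ[volume.restrict (Ioo 0 L)] ky x)
    {v v' : ℝ → ℝ} (hv : ∀ y, HasDerivAt v (v' y) y) (hv' : Continuous v') (hv0 : v 0 = 0) :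
    moment ky v x = -(b / 2) * (x * v x) - moment k v' x := by
  have hx' := Ioo_subset_Icc_self hx
  have hL : 0 < L := hx.1.trans hx.2
  obtain ⟨c, hc⟩ := hUY.exists_primitive hL
  have hend : c + ∫ t in 0..x, Y t = -(b / 2) * x := by
    refine Measure.eqOn_Icc_of_ae_eq (μ := volume) (a := x) (b := L) hx.2.ne
      (f := fun y => c + ∫ t in 0..y, Y t) (g := fun _ => -(b / 2) * x) ?_
      ((continuousOn_const.add (continuousOn_primitive_L2 hL.le Y)).mono
        (Icc_subset_Icc_left hx'.1)) continuousOn_const (left_mem_Icc.mpr hx'.2)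
    rw [Measure.restrict_congr_set Ioo_ae_eq_Icc.symm]
    filter_upwards [ae_restrict_of_ae_restrict_of_subset (Ioo_subset_Ioo_left hx'.1) hc,
      ae_restrict_of_ae_restrict_of_subset (Ioo_subset_Ioo_left hx'.1) (hU x hx'),
      ae_restrict_mem measurableSet_Ioo] with y h1 h2 h3
    rw [← h1, h2, extendKernel_of_lt h3.1]
  have h1 := integral_mul_eq_sub_integral_deriv_mul hv hv' (L2.intervalIntegrable Y hx') c
  rw [hend, hv0] at h1
  have e1 : ∫ y in 0..x, v y * Y y = moment ky v x := by
    refine integral_congr_Ioo hx'.1 le_rfl hx'.2 ?_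
    filter_upwards [hY] with y hy _
    rw [hy, mul_comm]
  have e2 : ∫ y in 0..x, v' y * (c + ∫ t in 0..y, Y t) = moment k v' x := by
    rw [← integral_inner_part hU v' hx']
    refine integral_congr_Ioo hx'.1 le_rfl hx'.2 ?_
    filter_upwards [hc] with y hy _
    rw [hy, mul_comm]
  rw [← e1, h1, e2]
  ring

end Regular

/-- The weak formulation tested with a function of `y` only. -/
theorem moment_identity {a b : ℝ} {k kx ky : ℝ → ℝ → ℝ} (hp : HasPartials b k kx ky)
    (hw : WeakIdentity a b k kx ky) {v v' v'' : ℝ → ℝ} (hv : ∀ y, HasDerivAt v (v' y) y)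
    (hv' : ∀ y, HasDerivAt v' (v'' y) y) (hv'' : Continuous v'') (hv0 : v' 0 = 0) {L : ℝ}
    (hL : 0 < L) :
    moment kx v L - b / 2 * (L * v L)
      = a * (∫ x in 0..L, moment k v x) + (∫ x in 0..L, moment k v'' x) - b * ∫ x in 0..L, v x := by
  obtain ⟨U, P, R, hUc, -, -, hae, -, -⟩ := hp L hL
  have hvc : Continuous v := continuous_iff_continuousAt.mpr fun y => (hv y).continuousAt
  have hvc' : Continuous v' := continuous_iff_continuousAt.mpr fun y => (hv' y).continuousAt
  have hL' : L ∈ Icc 0 L := right_mem_Icc.mpr hL.le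
  have hU : ∀ x ∈ Icc 0 L, (H1.toL2 L (U x) : ℝ → ℝ) =ᵐ[volume.restrict (Ioo 0 L)]
      extendKernel b k x := fun x hx => (hae x hx).1
  have hUc' : ContinuousOn (fun x => H1.toL2 L (U x)) (Icc 0 L) :=
    (H1.toL2 L).continuous.comp_continuousOn hUc
  set V := H1.ofDeriv hL.le hv hvc'
  set W := H1.ofDeriv hL.le (f := fun _ => 1) (f' := fun _ => 0)
    (fun y => hasDerivAt_const y 1) continuous_const
  have hV : (H1.toL2 L V : ℝ → ℝ) =ᵐ[volume.restrict (Ioo 0 L)] v := H1.toL2_ofDeriv hL.le hv hvc'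
  have hV' : (H1.weakDeriv L V : ℝ → ℝ) =ᵐ[volume.restrict (Ioo 0 L)] v' :=
    H1.weakDeriv_ofDeriv hL.le hv hvc'
  have hW : (H1.toL2 L W : ℝ → ℝ) =ᵐ[volume.restrict (Ioo 0 L)] fun _ => 1 :=
    H1.toL2_ofDeriv hL.le _ continuous_const
  have hW' : (H1.weakDeriv L W : ℝ → ℝ) =ᵐ[volume.restrict (Ioo 0 L)] fun _ => 0 :=
    H1.weakDeriv_ofDeriv hL.le _ continuous_const
  have h := hw L hL V W 1 ⟨fun _ => 1, continuousOn_const, hW, rfl⟩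
  rw [integral_toL2_eq hW' _ hL', integral_toL2_eq hV _ hL', integral_toL2_eq hW _ hL',
    integral_toL2_eq hW _ hL', integral_toL2_eq hW _ hL'] at h
  simp only [mul_zero, intervalIntegral.integral_zero, neg_zero, zero_add, one_mul, mul_one] at h
  have e0 := integral_toL2_eq hV (fun _ => 1) hL'
  simp only [one_mul] at e0
  have e1 : ∫ x in 0..L, (∫ y in 0..x, k x y * H1.toL2 L V y) = ∫ x in 0..L, moment k v x := by
    refine intervalIntegral.integral_congr fun x hx => ?_
    rw [uIcc_of_le hL.le] at hx
    exact integral_toL2_eq hV _ hx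
  have e2 : ∫ x in 0..L, (∫ y in 0..x, ky x y * H1.weakDeriv L V y)
      = ∫ x in 0..L, (-(b / 2) * (x * v' x) - moment k v'' x) := by
    refine integral_congr_Ioo hL.le le_rfl le_rfl (ae_of_all _ fun x hx => ?_)
    have hx' := Ioo_subset_Icc_self hx
    rw [integral_toL2_eq hV' _ hx']
    -- Applied to `v'` in place of `v`: the condition `v' 0 = 0` plays the role of the Neumann
    -- condition.
    exact moment_weakDeriv (U := fun x => H1.toL2 L (U x)) hU hx (H1.hasWeakDeriv (U x))
      (hae x hx').2.1 hv' hv'' hv0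
  have e3 : ∫ x in 0..L, (-(b / 2) * (x * v' x) - moment k v'' x)
      = -(b / 2) * (∫ x in 0..L, x * v' x) - ∫ x in 0..L, moment k v'' x := by
    have i1 : IntervalIntegrable (fun x => -(b / 2) * (x * v' x)) volume 0 L :=
      (continuous_const.mul (continuous_id.mul hvc')).intervalIntegrable _ _
    have i2 : IntervalIntegrable (moment k v'') volume 0 L := by
      refine ContinuousOn.intervalIntegrable ?_
      rw [uIcc_of_le hL.le]
      exact continuousOn_moment hUc' hU hv''
    rw [intervalIntegral.integral_sub i1 i2, intervalIntegral.integral_const_mul]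
  have e4 : ∫ x in 0..L, x * v' x = L * v L - ∫ x in 0..L, v x := by
    have := intervalIntegral.integral_mul_deriv_eq_deriv_mul (u := fun x => x) (u' := fun _ => 1)
      (v := v) (v' := v') (a := 0) (b := L) (fun x _ => hasDerivAt_id' x) (fun x _ => hv x)
      intervalIntegrable_const (hvc'.intervalIntegrable _ _)
    simpa using this
  rw [e0, e1, e2, e3, e4] at h
  simp only [moment] at h ⊢
  linarith

/-! ### Uniqueness of the kernel and of its derivatives -/

/-- In the difference of the two moment identities the `v''` terms and the data in `b` cancel, which
leaves `D' = a ∫ D`. -/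
theorem moment_eq_of_moment_eq {a b : ℝ} {k kx ky k' kx' ky' : ℝ → ℝ → ℝ}
    (hp : HasPartials b k kx ky) (hw : WeakIdentity a b k kx ky)
    (hp' : HasPartials b k' kx' ky') (hw' : WeakIdentity a b k' kx' ky')
    {v v' v'' : ℝ → ℝ} (hv : ∀ y, HasDerivAt v (v' y) y)
    (hv' : ∀ y, HasDerivAt v' (v'' y) y) (hv'' : Continuous v'') (hv0 : v' 0 = 0)
    (h : ∀ x, 0 ≤ x → moment k v'' x = moment k' v'' x) {L : ℝ} (hL : 0 < L) :
    moment k v L = moment k' v L := by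
  obtain ⟨U, P, R, hUc, -, -, hae, hUP, -⟩ := hp L hL
  obtain ⟨U', P', R', hUc', -, -, hae', hUP', -⟩ := hp' L hL
  have hvc : Continuous v := continuous_iff_continuousAt.mpr fun y => (hv y).continuousAt
  have c1 : ContinuousOn (moment k v) (Icc 0 L) :=
    continuousOn_moment ((H1.toL2 L).continuous.comp_continuousOn hUc)
      (fun x hx => (hae x hx).1) hvc
  have c2 : ContinuousOn (moment k' v) (Icc 0 L) :=
    continuousOn_moment ((H1.toL2 L).continuous.comp_continuousOn hUc')
      (fun x hx => (hae' x hx).1) hvc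
  refine sub_eq_zero.mp (eq_zero_of_hasDerivWithinAt_integral (a := a) hL
    (D := fun x => moment k v x - moment k' v x) (c1.sub c2) (by simp [moment]) (fun x hx => ?_) L
    (right_mem_Icc.mpr hL.le))
  have d1 := hasDerivWithinAt_moment (U := fun x => H1.toL2 L (U x)) (fun x hx => (hae x hx).1)
    (fun x hx => (hae x hx).2.2) hUP hvc hx
  have d2 := hasDerivWithinAt_moment (U := fun x => H1.toL2 L (U' x)) (fun x hx => (hae' x hx).1)
    (fun x hx => (hae' x hx).2.2) hUP' hvc hx
  refine (d1.sub d2).congr_deriv ?_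
  have hsub : uIcc 0 x ⊆ Icc 0 L := by
    rw [uIcc_of_le hx.1.le]
    exact Icc_subset_Icc_right hx.2
  rw [moment_identity hp hw hv hv' hv'' hv0 hx.1, moment_identity hp' hw' hv hv' hv'' hv0 hx.1,
    intervalIntegral.integral_sub (c1.mono hsub).intervalIntegrable
      (c2.mono hsub).intervalIntegrable]
  have e : ∫ t in 0..x, moment k v'' t = ∫ t in 0..x, moment k' v'' t := by
    refine intervalIntegral.integral_congr fun t ht => h t ?_
    rw [uIcc_of_le hx.1.le] at ht
    exact ht.1
  rw [e]
  ring

theorem moment_const_mul (k : ℝ → ℝ → ℝ) (c : ℝ) (v : ℝ → ℝ) (x : ℝ) :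
    moment k (fun y => c * v y) x = c * moment k v x := by
  simp only [moment]
  rw [← intervalIntegral.integral_const_mul]
  simp only [mul_left_comm]

/-- Even powers have zero slope at `0`, and two derivatives lower the exponent by two, so the
induction starts from `v = 1`, where `v'' = 0`. -/
theorem even_moments_eq {a b : ℝ} {k kx ky k' kx' ky' : ℝ → ℝ → ℝ}
    (hp : HasPartials b k kx ky) (hw : WeakIdentity a b k kx ky)
    (hp' : HasPartials b k' kx' ky') (hw' : WeakIdentity a b k' kx' ky') (n : ℕ) :
    ∀ x, 0 ≤ x → moment k (fun y => y ^ (2 * n)) x = moment k' (fun y => y ^ (2 * n)) x := by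
  induction n with
  | zero =>
    intro x hx
    rcases hx.eq_or_lt with rfl | hx
    · simp [moment]
    · refine moment_eq_of_moment_eq hp hw hp' hw' (v' := fun _ => 0) (v'' := fun _ => 0)
        (fun y => ?_) (fun y => hasDerivAt_const y 0) continuous_const rfl (by simp [moment]) hx
      simpa using hasDerivAt_const y (1 : ℝ)
  | succ n ih =>
    intro x hx
    rcases hx.eq_or_lt with rfl | hx
    · simp [moment]
    · refine moment_eq_of_moment_eq hp hw hp' hw'
        (v' := fun y => (2 * n + 2 : ℝ) * y ^ (2 * n + 1))
        (v'' := fun y => (2 * n + 2 : ℝ) * (2 * n + 1) * y ^ (2 * n))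
        (fun y => ?_) (fun y => ?_) (by fun_prop) (by simp) (fun t ht => ?_) hx
      · have := hasDerivAt_pow (2 * (n + 1)) y
        refine this.congr_deriv ?_
        rw [show 2 * (n + 1) - 1 = 2 * n + 1 by omega]
        push_cast
        ring
      · refine ((hasDerivAt_pow (2 * n + 1) y).const_mul (2 * n + 2 : ℝ)).congr_deriv ?_
        rw [Nat.add_sub_cancel]
        push_cast
        ring
      · rw [moment_const_mul, moment_const_mul, ih t ht]

theorem HasPartials.integrableOn {b : ℝ} {k kx ky : ℝ → ℝ → ℝ} (hp : HasPartials b k kx ky) {x : ℝ}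
    (hx : 0 < x) : IntegrableOn (k x) (Ioo 0 x) := by
  obtain ⟨U, P, R, -, -, -, hae, -, -⟩ := hp x hx
  refine Integrable.congr (L2.integrableOn (H1.toL2 x (U x))) ?_
  filter_upwards [(hae x (right_mem_Icc.mpr hx.le)).1, ae_restrict_mem measurableSet_Ioo]
    with y hy hyx
  rw [hy, extendKernel_of_le hyx.1 hyx.2.le]

theorem weakSolution_unique {a b : ℝ} {k k' : ℝ → ℝ → ℝ} (h : IsWeakSolution a b k)
    (h' : IsWeakSolution a b k') {x : ℝ} (hx : 0 < x) :
    ∀ᵐ y ∂(volume.restrict (Ioo 0 x)), k x y = k' x y := by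
  obtain ⟨kx, ky, hp, hw⟩ := h
  obtain ⟨kx', ky', hp', hw'⟩ := h'
  have i := hp.integrableOn hx
  have i' := hp'.integrableOn hx
  refine (ae_eq_zero_of_even_moments (f := fun y => k x y - k' x y) (i.sub i') fun n => ?_).mono
    fun y hy => sub_eq_zero.mp hy
  have hm := even_moments_eq hp hw hp' hw' n x hx.le
  have hi : ∀ {f : ℝ → ℝ}, IntegrableOn f (Ioo 0 x) →
      IntegrableOn (fun y => f y * y ^ (2 * n)) (Ioo 0 x) := by
    intro f hf
    refine hf.mul_bdd (c := x ^ (2 * n)) (by fun_prop) ?_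
    filter_upwards [ae_restrict_mem measurableSet_Ioo] with y hy
    rw [norm_pow, Real.norm_eq_abs, abs_of_pos hy.1]
    exact pow_le_pow_left₀ hy.1.le hy.2.le _
  simp only [moment] at hm
  rw [integral_zero_eq_Ioo hx.le, integral_zero_eq_Ioo hx.le] at hm
  simp only [sub_mul]
  rw [integral_sub (hi i) (hi i'), hm, sub_self]

/-- The partial derivatives are determined by the kernel. -/
theorem HasPartials.unique {b : ℝ} {k kx ky k' kx' ky' : ℝ → ℝ → ℝ}
    (hp : HasPartials b k kx ky) (hp' : HasPartials b k' kx' ky')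
    (h : ∀ x, 0 < x → ∀ᵐ y ∂(volume.restrict (Ioo 0 x)), k x y = k' x y) {x : ℝ} (hx : 0 < x) :
    ∀ᵐ y ∂(volume.restrict (Ioo 0 x)), kx x y = kx' x y ∧ ky x y = ky' x y := by
  obtain ⟨U, P, R, -, -, -, hae, hUP, -⟩ := hp x hx
  obtain ⟨U', P', R', -, -, -, hae', hUP', -⟩ := hp' x hx
  have hxx : x ∈ Icc 0 x := right_mem_Icc.mpr hx.le
  have hU : ∀ s ∈ Icc 0 x, H1.toL2 x (U s) = H1.toL2 x (U' s) := by
    intro s hs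
    refine Lp.ext ((hae s hs).1.trans (EventuallyEq.trans ?_ (hae' s hs).1.symm))
    rcases hs.1.eq_or_lt with rfl | hs0
    · filter_upwards [ae_restrict_mem measurableSet_Ioo] with y hy
      rw [extendKernel_of_lt hy.1, extendKernel_of_lt hy.1]
    · have h1 := (ae_restrict_iff' measurableSet_Ioo).mp (h s hs0)
      filter_upwards [ae_restrict_mem measurableSet_Ioo, ae_restrict_of_ae h1,
        ae_ne_restrict _ s] with y hy hys hne
      rcases lt_or_gt_of_ne hne with hlt | hlt
      · rw [extendKernel_of_le hy.1 hlt.le, extendKernel_of_le hy.1 hlt.le, hys ⟨hy.1, hlt⟩]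
      · rw [extendKernel_of_lt hlt, extendKernel_of_lt hlt]
  have hP : P x = P' x :=
    (uniqueDiffOn_Icc hx x hxx).eq_deriv _ (hUP x hxx) ((hUP' x hxx).congr_of_mem hU hxx)
  have hY : H1.weakDeriv x (U x) = H1.weakDeriv x (U' x) :=
    (H1.hasWeakDeriv (U x)).unique ((hU x hxx) ▸ H1.hasWeakDeriv (U' x))
  filter_upwards [(hae x hxx).2.1, (hae x hxx).2.2, (hae' x hxx).2.1, (hae' x hxx).2.2]
    with y h1 h2 h3 h4
  rw [← h1, ← h2, ← h3, ← h4, hP, hY]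
  exact ⟨rfl, rfl⟩

theorem existsUniqueKernel_isWeakSolution (a b : ℝ) : ExistsUniqueKernel (IsWeakSolution a b) :=
  ⟨besselKernel a b, (isClassicalKernel_besselKernel a b).isWeakSolution, fun _ h _ hx =>
    weakSolution_unique h (isClassicalKernel_besselKernel a b).isWeakSolution hx⟩

theorem ae_eq_besselKernel {a b : ℝ} {k kx ky : ℝ → ℝ → ℝ} (h : IsWeakSolution a b k)
    (hp : HasPartials b k kx ky) {x : ℝ} (hx : 0 < x) :
    ∀ᵐ y ∂(volume.restrict (Ioo 0 x)), k x y = besselKernel a b x y ∧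
      kx x y = besselKernelX a b x y ∧ ky x y = besselKernelY a b x y := by
  have hc := isClassicalKernel_besselKernel a b
  have hk : ∀ x, 0 < x → ∀ᵐ y ∂(volume.restrict (Ioo 0 x)), k x y = besselKernel a b x y :=
    fun x hx => weakSolution_unique h hc.isWeakSolution hx
  filter_upwards [hk x hx, hp.unique hc.hasPartials hk hx, ae_restrict_mem measurableSet_Ioo]
    with y h1 h2 hy
  rw [h2.1, h2.2, glue, glue, if_pos hy.2, if_pos hy.2]
  exact ⟨h1, rfl, rfl⟩

/-! ### Energy estimates -/

/-- Serves both problems, `a = A` and `a = -A`: the sign of `a` matters only for the bound `E` on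
`bes`. -/
theorem sliceEnergy_le {a A : ℝ} (ha : |a| = A) {k kx ky : ℝ → ℝ → ℝ}
    (h : IsWeakSolution a A k) (hp : HasPartials A k kx ky) {x E : ℝ} (hx : 0 < x)
    (hE : ∀ y ∈ Ioo 0 x, ∀ m, |bes m (a / 4 * (x ^ 2 - y ^ 2))| ≤ E) :
    sliceEnergy k kx ky x
      ≤ x * (A ^ 2 / 4 * E ^ 2 * (x ^ 2 + ((1 + A * x ^ 2 / 2) ^ 2 + (A * x ^ 2 / 2) ^ 2))) := by
  have hA : 0 ≤ A := ha ▸ abs_nonneg a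
  rw [sliceEnergy, integral_zero_eq_Ioo hx.le]
  refine (le_abs_self _).trans ?_
  rw [← Real.norm_eq_abs]
  refine (norm_integral_le_of_norm_le (integrable_const (A ^ 2 / 4 * E ^ 2 *
    (x ^ 2 + ((1 + A * x ^ 2 / 2) ^ 2 + (A * x ^ 2 / 2) ^ 2)))) ?_).trans ?_
  · filter_upwards [ae_eq_besselKernel h hp hx, ae_restrict_mem measurableSet_Ioo] with y hy hyx
    rw [hy.1, hy.2.1, hy.2.2, Real.norm_eq_abs, abs_of_nonneg (by positivity)]
    have h1 := hE y hyx 1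
    have h2 := hE y hyx 2
    have hE0 : 0 ≤ E := (abs_nonneg _).trans h1
    set B₁ := bes 1 (a / 4 * (x ^ 2 - y ^ 2))
    set B₂ := bes 2 (a / 4 * (x ^ 2 - y ^ 2))
    have b1 : |besselKernel a A x y| ≤ A / 2 * E * x := by
      rw [besselKernel, abs_mul, abs_mul, abs_neg, abs_of_nonneg (by positivity : 0 ≤ A / 2),
        abs_of_pos hx]
      calc A / 2 * (x * |B₁|) ≤ A / 2 * (x * E) := by gcongr
        _ = _ := by ring
    have b2 : |besselKernelX a A x y| ≤ A / 2 * E * (1 + A * x ^ 2 / 2) := by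
      rw [besselKernelX, abs_mul, abs_neg, abs_of_nonneg (by positivity : 0 ≤ A / 2)]
      have : |a / 2 * x ^ 2 * B₂| ≤ A / 2 * x ^ 2 * E := by
        rw [abs_mul, abs_mul, abs_div, ha, abs_of_pos (by norm_num : (0 : ℝ) < 2), abs_pow,
          abs_of_pos hx]
        gcongr
      calc A / 2 * |B₁ + a / 2 * x ^ 2 * B₂| ≤ A / 2 * (E + A / 2 * x ^ 2 * E) := by
            gcongr
            exact (abs_add_le _ _).trans (add_le_add h1 this)
        _ = _ := by ring
    have b3 : |besselKernelY a A x y| ≤ A / 2 * E * (A * x ^ 2 / 2) := by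
      rw [besselKernelY, abs_mul, abs_of_nonneg (by positivity : 0 ≤ A / 2), abs_mul, abs_mul,
        abs_mul, abs_div, ha, abs_of_pos (by norm_num : (0 : ℝ) < 2), abs_of_pos hx,
        abs_of_pos hyx.1]
      calc A / 2 * (A / 2 * x * y * |B₂|) ≤ A / 2 * (A / 2 * x * x * E) := by
            have := hyx.2.le
            gcongr
        _ = _ := by ring
    have s1 := pow_le_pow_left₀ (abs_nonneg _) b1 2
    have s2 := pow_le_pow_left₀ (abs_nonneg _) b2 2
    have s3 := pow_le_pow_left₀ (abs_nonneg _) b3 2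
    rw [sq_abs] at s1 s2 s3
    calc _ ≤ _ := add_le_add s1 (add_le_add s2 s3)
      _ = _ := by ring
  · rw [integral_const, smul_eq_mul]
    simp [hx.le]

theorem abs_bes_direct_le {A x y : ℝ} (hA : 0 ≤ A) (hy : y ∈ Ioo 0 x) (m : ℕ) :
    |bes m (A / 4 * (x ^ 2 - y ^ 2))| ≤ Real.exp (x * √A) := by
  have hx : 0 < x := hy.1.trans hy.2
  have hyx : y ^ 2 ≤ x ^ 2 := pow_le_pow_left₀ hy.1.le hy.2.le 2
  refine (abs_bes_le_exp m (mul_nonneg (by positivity) (sub_nonneg.mpr hyx))).trans ?_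
  refine Real.exp_le_exp.mpr ?_
  have : √(A / 4 * (x ^ 2 - y ^ 2)) ≤ x * √A / 2 := by
    refine Real.sqrt_le_iff.mpr ⟨by positivity, ?_⟩
    rw [div_pow, mul_pow, Real.sq_sqrt hA]
    nlinarith [mul_nonneg hA (sq_nonneg y)]
  linarith

theorem abs_bes_inverse_le {A x y : ℝ} (hA : 0 ≤ A) (hy : y ∈ Ioo 0 x) (m : ℕ) :
    |bes m (-A / 4 * (x ^ 2 - y ^ 2))| ≤ 1 := by
  have hyx : y ^ 2 ≤ x ^ 2 := pow_le_pow_left₀ hy.1.le hy.2.le 2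
  have := abs_bes_neg_le_one m (s := A / 4 * (x ^ 2 - y ^ 2))
    (mul_nonneg (by positivity) (sub_nonneg.mpr hyx))
  rwa [show -A / 4 * (x ^ 2 - y ^ 2) = -(A / 4 * (x ^ 2 - y ^ 2)) by ring]

theorem polynomial_le_exp {z : ℝ} (hz : 0 ≤ z) :
    z ^ 2 + ((1 + z ^ 2 / 2) ^ 2 + (z ^ 2 / 2) ^ 2) ≤ 6 * Real.exp z ^ 2 := by
  have h0 := Real.quadratic_le_exp_of_nonneg hz
  have h1 : z ≤ Real.exp z := by nlinarith [sq_nonneg z]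
  have h2 : 1 + z ^ 2 / 2 ≤ Real.exp z := by linarith
  have h3 : z ^ 2 / 2 ≤ Real.exp z := by linarith
  have s1 := pow_le_pow_left₀ hz h1 2
  have s2 := pow_le_pow_left₀ (by positivity) h2 2
  have s3 := pow_le_pow_left₀ (by positivity) h3 2
  nlinarith [sq_nonneg (Real.exp z)]

/-- Every factor is absorbed into a power of `X = exp (e √A)`: `x ≤ X`, `A² ≤ X⁴ / e₀⁴`, the squared
exponential is at most `X²`, and the polynomial at most `6 X²`. The total power is `9`. The lower
bound `e₀ ≤ e` is what controls `A` by `e² A`. -/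
theorem direct_energy_bound {e₀ e A x : ℝ} (he₀ : 0 < e₀) (he : e₀ ≤ e) (hA : 1 ≤ A)
    (hx : x ∈ Ioo 0 e) :
    x * (A ^ 2 / 4 * Real.exp (x * √A) ^ 2
        * (x ^ 2 + ((1 + A * x ^ 2 / 2) ^ 2 + (A * x ^ 2 / 2) ^ 2)))
      ≤ (2 / e₀ ^ 4 + 2) * Real.exp (9 * e * √A) := by
  have hA0 : 0 ≤ A := zero_le_one.trans hA
  have he0 : 0 < e := he₀.trans_le he
  have hs1 : 1 ≤ √A := Real.one_le_sqrt.mpr hA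
  set z := e * √A with hz
  have hz0 : 0 ≤ z := by positivity
  set X := Real.exp z with hX
  have hX0 : 0 < X := Real.exp_pos z
  have hzX : z ≤ X := by linarith [Real.add_one_le_exp z]
  have hxz : x ≤ z := hx.2.le.trans (le_mul_of_one_le_right he0.le hs1)
  have hx0 := hx.1.le
  have hAx : A * x ^ 2 ≤ z ^ 2 := by
    rw [hz, mul_pow, Real.sq_sqrt hA0, mul_comm]
    have := hx.2.le
    gcongr
  have hAz : A ≤ X ^ 2 / e₀ ^ 2 := by
    rw [le_div_iff₀ (by positivity)]
    calc A * e₀ ^ 2 ≤ A * e ^ 2 := by gcongr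
      _ = z ^ 2 := by rw [hz, mul_pow, Real.sq_sqrt hA0, mul_comm]
      _ ≤ X ^ 2 := by gcongr
  have hexp : Real.exp (x * √A) ≤ X := Real.exp_le_exp.mpr (by
    rw [hz]; have := hx.2.le; gcongr)
  have hpoly : x ^ 2 + ((1 + A * x ^ 2 / 2) ^ 2 + (A * x ^ 2 / 2) ^ 2) ≤ 6 * X ^ 2 := by
    refine le_trans ?_ (polynomial_le_exp hz0)
    gcongr
  calc _ ≤ X * ((X ^ 2 / e₀ ^ 2) ^ 2 / 4 * X ^ 2 * (6 * X ^ 2)) := by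
        have := hxz.trans hzX
        gcongr
    _ = 3 / 2 / e₀ ^ 4 * X ^ 9 := by field_simp; ring
    _ ≤ (2 / e₀ ^ 4 + 2) * X ^ 9 := by
        gcongr
        have : 3 / 2 / e₀ ^ 4 ≤ 2 / e₀ ^ 4 := by gcongr; norm_num
        linarith
    _ = _ := by
        rw [hX, ← Real.exp_nat_mul, hz]
        congr 2
        push_cast
        ring

/-- The prefactor contributes `A²` and the polynomial another `A²`. The rest is at most `X³` with `X
= exp e`, enlarged to `X⁹` so that both estimates share their constants. -/
theorem inverse_energy_bound {e₀ e A x : ℝ} (he₀ : 0 < e₀) (hA : 1 ≤ A) (hx : x ∈ Ioo 0 e) :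
    x * (A ^ 2 / 4 * 1 ^ 2 * (x ^ 2 + ((1 + A * x ^ 2 / 2) ^ 2 + (A * x ^ 2 / 2) ^ 2)))
      ≤ (2 / e₀ ^ 4 + 2) * A ^ 4 * Real.exp (9 * e) := by
  have hA0 : 0 ≤ A := zero_le_one.trans hA
  have hx0 := hx.1.le
  have he0 : 0 ≤ e := hx0.trans hx.2.le
  set X := Real.exp e with hX
  have hX1 : 1 ≤ X := Real.one_le_exp he0
  have heX : x ≤ X := by linarith [Real.add_one_le_exp e, hx.2]
  have hpoly : x ^ 2 + ((1 + A * x ^ 2 / 2) ^ 2 + (A * x ^ 2 / 2) ^ 2) ≤ A ^ 2 * (6 * X ^ 2) := by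
    calc x ^ 2 + ((1 + A * x ^ 2 / 2) ^ 2 + (A * x ^ 2 / 2) ^ 2)
        ≤ (A * x) ^ 2 + ((A * (1 + x ^ 2 / 2)) ^ 2 + (A * (x ^ 2 / 2)) ^ 2) := by
          have h1 : x ≤ A * x := le_mul_of_one_le_left hx0 hA
          have h2 : 1 + A * x ^ 2 / 2 ≤ A * (1 + x ^ 2 / 2) := by linarith
          have h3 : A * x ^ 2 / 2 = A * (x ^ 2 / 2) := by ring
          rw [← h3]
          gcongr
      _ = A ^ 2 * (x ^ 2 + ((1 + x ^ 2 / 2) ^ 2 + (x ^ 2 / 2) ^ 2)) := by ring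
      _ ≤ A ^ 2 * (e ^ 2 + ((1 + e ^ 2 / 2) ^ 2 + (e ^ 2 / 2) ^ 2)) := by
          have := hx.2.le
          gcongr
      _ ≤ _ := by
          gcongr
          exact polynomial_le_exp he0
  calc _ ≤ X * (A ^ 2 / 4 * 1 ^ 2 * (A ^ 2 * (6 * X ^ 2))) := by gcongr
    _ = 3 / 2 * A ^ 4 * X ^ 3 := by ring
    _ ≤ (2 / e₀ ^ 4 + 2) * A ^ 4 * X ^ 9 := by
        have : 0 < 2 / e₀ ^ 4 := by positivity
        gcongr
        · linarith
        · norm_num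
    _ = _ := by
        rw [hX, ← Real.exp_nat_mul]
        norm_num

end KernelProblem

end

theorem proposition3 (e₀ vbar : ℝ) (he₀ : 0 < e₀) (hvbar : 0 < vbar) :
    (∀ σ : ℝ, 0 < σ → ∀ lam : ℝ, 0 ≤ lam →
      KernelProblem.ExistsUniqueKernel (KernelProblem.IsDirectKernel σ lam) ∧
      KernelProblem.ExistsUniqueKernel (KernelProblem.IsInverseKernel σ lam)) ∧
    ∃ C c : ℝ, 0 < C ∧ 0 < c ∧
      ∀ σ : ℝ, 0 < σ → ∃ lamσ : ℝ, 0 < lamσ ∧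
        ∀ lam : ℝ, lamσ ≤ lam → ∀ t : ℝ, 0 ≤ t →
          ∀ x ∈ Set.Ioo 0 (KernelProblem.thickness e₀ vbar t),
            (∀ k kx ky : ℝ → ℝ → ℝ, KernelProblem.IsDirectKernel σ lam k →
              KernelProblem.HasPartials (lam / σ) k kx ky →
              KernelProblem.sliceEnergy k kx ky x
                ≤ C * Real.exp (c * KernelProblem.thickness e₀ vbar t * Real.sqrt (lam / σ))) ∧
            (∀ l lx ly : ℝ → ℝ → ℝ, KernelProblem.IsInverseKernel σ lam l →
              KernelProblem.HasPartials (lam / σ) l lx ly →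
              KernelProblem.sliceEnergy l lx ly x
                ≤ C * (lam / σ) ^ 4
                  * Real.exp (c * KernelProblem.thickness e₀ vbar t)) := by
  refine ⟨fun σ _ lam _ => ⟨KernelProblem.existsUniqueKernel_isWeakSolution _ _,
    KernelProblem.existsUniqueKernel_isWeakSolution _ _⟩, 2 / e₀ ^ 4 + 2, 9, by positivity,
    by norm_num, fun σ hσ => ⟨σ, hσ, fun lam hlam t ht x hx => ?_⟩⟩
  -- The threshold `σ` for `lam` is chosen exactly so that `lam / σ ≥ 1`.
  have hA : 1 ≤ lam / σ := by rwa [one_le_div hσ]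
  have hA0 : 0 ≤ lam / σ := zero_le_one.trans hA
  have he : e₀ ≤ KernelProblem.thickness e₀ vbar t :=
    le_add_of_nonneg_right (mul_nonneg ht hvbar.le)
  exact ⟨fun k kx ky h hp => (KernelProblem.sliceEnergy_le (abs_of_nonneg hA0) h hp hx.1
      fun y hy m => KernelProblem.abs_bes_direct_le hA0 hy m).trans
      (KernelProblem.direct_energy_bound he₀ he hA hx),
    fun l lx ly h hp => (KernelProblem.sliceEnergy_le (by rw [abs_neg, abs_of_nonneg hA0]) h hp
      hx.1 fun y hy m => KernelProblem.abs_bes_inverse_le hA0 hy m).trans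
      (KernelProblem.inverse_energy_bound he₀ hA hx)⟩
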